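/- **Setting.** Let $A\in\mathbb Z^{r\times n}$ and $\mathbf b\in\mathbb Z^r$, and let $$M=\begin{pmatrix}\mathrm{id}_n&\mathbf 0\\ A&-\mathbf b\end{pmatrix},$$ an $(n+r)\times(n+1)$ matrix with columns $\gamma_1,\dots,\gamma_{n+1}$. Put $\mathbf y=(y_1,\dots,y_n)$, $\Lambda=(\lambda_1,\dots,\lambda_r)$ and $$[M]=\frac{(\mathbf y,\Lambda)^{\gamma_{n+1}}}{\prod_{j=1}^n\bigl(1-(\mathbf y,\Lambda)^{\gamma_j}\bigr)}.$$ Fractional rational functions (rational exponents allowed) are expanded in the field of formal series over $\mathbb C$ whose set of exponent vectors is well-ordered lexicographically in the variable order $y_1,\dots,y_n,\lambda_1,\dots,\lambda_r$. So $1/(1-T)=\sum_{k\ge0}T^k$ for a monomial $T$ whose exponent vector has positive first nonzero entry, and $1/(1-T)=-\sum_{k\ge0}T^{-k-1}$ if that entry is negative. **Operators.** $\mathcal Z_{y_j}$ keeps exactly the terms with an integer exponent of $y_j$. Let $$E=\frac{L}{\prod_{s=1}^n(1-u_s\lambda_i^{b_s})},$$ where $L$ is a fractional Laurent polynomial, each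 $u_s$ is a scalar (possibly $0$) times a fractional monomial free of $\lambda_i$, $b_j\neq0$, $u_j=y_ju_j'\ne0$, the variable $y_j$ occurs nowhere else, and the other denominator factors are coprime to the $j$-th one (they do not vanish under the substitution below). Then define $$\mathrm{CT}_{\lambda_i,j}E=\operatorname{sgn}(b_j)\,\mathcal Z_{y_j}\Bigl(\bigl(E\,(1-u_j\lambda_i^{b_j})\bigr)\big|_{\lambda_i=(y_ju_j')^{-1/b_j}}\Bigr).$$ Extend $\mathrm{CT}_{\lambda_i,j}$ additively to finite sums of such functions. **Pivoting.** $M\leftarrow(i,j)$ is obtained from $M$ by adding $-m_{n+i,s}/m_{n+i,j}$ times column $j$ to column $s$, for every $s\neq j$. The entry $m_{n+i,j}$ is the pivot item. Let $i_1,\dots,i_r\in[r]$ be distinct and $j_1,\dots,j_r\in[n]$ be distinct, such that all pivot items met in $M\leftarrow(i_1,j_1)\leftarrow\cdots\leftarrow(i_r,j_r)$ are nonzero. Put $J=\{j_1,\dots,j_r\}$, and let $M_r\langle J\rangle$ be this last matrix with rows $n+1,\dots,n+r$ and the columns in $J$ removed. It has columns $w_1,\dots,w_{n-r},v\in\mathbb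 Q^n$. **Theorem.** 1. The vectors $w_1,\dots,w_{n-r}$ are linearly independent, so $$K^v=v+\Bigl\{\sum_s k_sw_s:\ k_s\in\mathbb R_{\ge0}\Bigr\}$$ is a shifted simplicial cone. 2. The lattice point generating function $\sigma_{K^v}(\mathbf y)=\sum_{\alpha\in K^v\cap\mathbb Z^n}\mathbf y^\alpha$ is a well-defined rational function. That is, there are Laurent polynomials $P$ and $Q\ne0$ in $\mathbf y$ with $Q\cdot\sigma_{K^v}=P$ as formal series, and the quotient $P/Q$ does not depend on their choice. Moreover, the iterated constant term below is well defined, and as rational functions $$\mathrm{CT}_{\lambda_{i_r},j_r}\cdots\mathrm{CT}_{\lambda_{i_2},j_2}\,\mathrm{CT}_{\lambda_{i_1},j_1}[M]=\operatorname{sgn}\Bigl(\det\bigl(A_{i_s,j_t}\bigr)_{s,t=1}^r\Bigr)\,\sigma_{K^v}(\mathbf y).$$ 3. The columns of $M_r\langle J\rangle$ (the generators and the vertex) depend only on the set $J$: every other admissible choice of $(i_1,\dots,i_r)$ and $(j_1,\dots,j_r)$ with the same set $J$ gives the same columns. -/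

import Mathlib

noncomputable section ConstantTerm

/-- Exponent vectors of fractional monomials in `y_1, …, y_n, λ_1, …, λ_r`
(in this order), compared lexicographically: `0 < κ` iff the first nonzero entry of `κ` is
positive, i.e. iff the monomial with exponent `κ` is small. -/
abbrev ExpVec (n r : ℕ) : Type := Lex (Fin (n + r) → ℚ)

/-- The field of fractional (iterated Laurent) series in the variables `y, Λ`: formal series with
rational exponents and with support well-ordered for the lexicographic order.  Inverses in this
field are the series expansions `1/(1-M) = ∑ M^k` for `M` small and
`1/(1-M) = -∑ M^(-k-1)` for `M` large. -/
abbrev FracSeries (n r : ℕ) : Type := HahnSeries (ExpVec n r) ℂ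

/-- The position of the variable `y_j` (row `j` of the matrices below). -/
abbrev yIdx {n : ℕ} (r : ℕ) (j : Fin n) : Fin (n + r) := Fin.castAdd r j

/-- The position of the variable `λ_i` (row `n + i` of the matrices below). -/
abbrev lamIdx (n : ℕ) {r : ℕ} (i : Fin r) : Fin (n + r) := Fin.natAdd n i

/-- The monomial `c (y, Λ)^κ`. -/
def mono {n r : ℕ} (κ : Fin (n + r) → ℚ) (c : ℂ) : FracSeries n r :=
  HahnSeries.single (toLex κ) c

/-- Fractional Laurent polynomials in `y, Λ`, as finitely supported families of coefficients. -/
abbrev FracLaurent (n r : ℕ) : Type := (Fin (n + r) → ℚ) →₀ ℂ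

/-- A fractional Laurent polynomial as a series. -/
def FracLaurent.toSeries {n r : ℕ} (L : FracLaurent n r) : FracSeries n r :=
  L.sum fun κ a => mono κ a

open scoped Classical in
/-- The operator `Z_{y_j}`: keep the terms in which the exponent of `y_j` is an integer. -/
def Zop {n r : ℕ} (j : Fin n) (F : FracSeries n r) : FracSeries n r where
  coeff κ := if ∃ m : ℤ, ofLex κ (yIdx r j) = m then F.coeff κ else 0
  isPWO_support' := F.isPWO_support.mono fun κ hκ h => hκ (by simp [h])

/-- The data of a fractional rational function
`L / ∏_{s=1}^n (1 - c_s (y, Λ)^{γ_s})` written with `n` denominator factors; a factor that has been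
replaced by `1` has `c_s = 0`. -/
structure EForm (n r : ℕ) where
  num : FracLaurent n r
  coef : Fin n → ℂ
  expo : Fin n → Fin (n + r) → ℚ

namespace EForm

variable {n r : ℕ}

/-- The series of `L / ∏ (1 - c_s (y, Λ)^{γ_s})`. -/
def val (E : EForm n r) : FracSeries n r :=
  E.num.toSeries / ∏ s, (1 - mono (E.expo s) (E.coef s))

/-- The exponent `b_j` of `λ_i` in the `j`-th denominator factor `1 - u_j λ_i^{b_j}`. -/
def lamExp (E : EForm n r) (i : Fin r) (j : Fin n) : ℚ := E.expo j (lamIdx n i)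

/-- The exponent of the image of the monomial `(y, Λ)^κ` under the substitution
`λ_i = u_j^{-1/b_j}`, where `u_j λ_i^{b_j} = c_j (y, Λ)^{γ_j}`. -/
def substExp (E : EForm n r) (i : Fin r) (j : Fin n) (κ : Fin (n + r) → ℚ) : Fin (n + r) → ℚ :=
  κ - (κ (lamIdx n i) / E.lamExp i j) • E.expo j

/-- The scalar `c_j^{-κ_i / b_j}` that the substitution `λ_i = u_j^{-1/b_j}` produces from
`(y, Λ)^κ`.  The choice of the branch of the power does not matter after `Z_{y_j}`. -/
def substCoef (E : EForm n r) (i : Fin r) (j : Fin n) (κ : Fin (n + r) → ℚ) : ℂ :=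
  (E.coef j) ^ ((-(κ (lamIdx n i) / E.lamExp i j) : ℚ) : ℂ)

/-- The substitution `λ_i = u_j^{-1/b_j}` in the monomial `a (y, Λ)^κ`. -/
def substMono (E : EForm n r) (i : Fin r) (j : Fin n) (κ : Fin (n + r) → ℚ) (a : ℂ) :
    FracSeries n r :=
  mono (E.substExp i j κ) (a * E.substCoef i j κ)

/-- `E` has the form to which `CT_{λ_i, j}` applies: in the `j`-th factor `1 - u_j λ_i^{b_j}`
one has `b_j ≠ 0` and `u_j = y_j u_j'`, the variable `y_j` occurs nowhere else, and no other
denominator factor vanishes under `λ_i = u_j^{-1/b_j}` (it is coprime to the `j`-th one). -/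
structure Admissible (E : EForm n r) (i : Fin r) (j : Fin n) : Prop where
  coef_ne : E.coef j ≠ 0
  lam_ne : E.lamExp i j ≠ 0
  y_self : E.expo j (yIdx r j) = 1
  y_other : ∀ s, s ≠ j → E.coef s = 0 ∨ E.expo s (yIdx r j) = 0
  y_num : ∀ κ ∈ E.num.support, κ (yIdx r j) = 0
  coprime : ∀ s, s ≠ j → 1 - E.substMono i j (E.expo s) (E.coef s) ≠ 0

/-- `sgn(b_j) Z_{y_j} ( (E (1 - u_j λ_i^{b_j})) |_{λ_i = u_j^{-1/b_j}} )`. -/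
def ct (E : EForm n r) (i : Fin r) (j : Fin n) : FracSeries n r :=
  ((SignType.sign (E.lamExp i j) : ℤ) : FracSeries n r) *
    Zop j ((E.num.sum fun κ a => E.substMono i j κ a) /
      ∏ s ∈ Finset.univ.erase j, (1 - E.substMono i j (E.expo s) (E.coef s)))

end EForm

/-- `IsCT i j F R`: the single-factor constant term `CT_{λ_i, j} F` is defined and equals `R`.
It is given by `EForm.ct` on rational functions of the admissible form.  It is extended
additively to finite sums of these: a result `Z_y [..]` of a previous constant term is no longer
of the admissible form itself, but it is a sum of such functions, conjugate under roots of unity.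
(The value does not depend on the decomposition, by uniqueness of partial fractions
in `y_j`.) -/
def IsCT {n r : ℕ} (i : Fin r) (j : Fin n) (F R : FracSeries n r) : Prop :=
  ∃ l : List (EForm n r), (∀ E ∈ l, E.Admissible i j) ∧
    F = (l.map EForm.val).sum ∧ R = (l.map fun E => E.ct i j).sum

/-- `IsIterCT [(i_1, j_1), …, (i_k, j_k)] F R`: the iterated constant term
`CT_{λ_{i_k}, j_k} ⋯ CT_{λ_{i_1}, j_1} F` is defined and equals `R`. -/
def IsIterCT {n r : ℕ} : List (Fin r × Fin n) → FracSeries n r → FracSeries n r → Prop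
  | [], F, R => R = F
  | p :: l, F, R => ∃ F', IsCT p.1 p.2 F F' ∧ IsIterCT l F' R

/-- The `(n + r) × (n + 1)` matrix `M = (id_n, 0; A, -b)`. -/
def systemMatrix {n r : ℕ} (A : Matrix (Fin r) (Fin n) ℤ) (b : Fin r → ℤ) :
    Matrix (Fin (n + r)) (Fin (n + 1)) ℚ :=
  Matrix.reindex finSumFinEquiv finSumFinEquiv
    (Matrix.fromBlocks 1 0 (A.map (Int.cast : ℤ → ℚ))
      (Matrix.of fun i (_ : Fin 1) => -(b i : ℚ)))

/-- The Erat form `[M] = (y, Λ)^{γ_{n+1}} / ∏_{j=1}^n (1 - (y, Λ)^{γ_j})`, where `γ_j` is the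
`j`-th column of `M`. -/
def erat {n r : ℕ} (M : Matrix (Fin (n + r)) (Fin (n + 1)) ℚ) : FracSeries n r :=
  mono (fun p => M p (Fin.last n)) 1 / ∏ j : Fin n, (1 - mono (fun p => M p j.castSucc) 1)

/-- The pivot operation `M ← (i, j)`: Gaussian column elimination with the `(n + i, j)` entry as
the pivot. -/
def pivot {n r : ℕ} (M : Matrix (Fin (n + r)) (Fin (n + 1)) ℚ) (i : Fin r) (j : Fin n) :
    Matrix (Fin (n + r)) (Fin (n + 1)) ℚ :=
  Matrix.of fun p s =>
    if s = j.castSucc then M p s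
    else M p s - M (lamIdx n i) s / M (lamIdx n i) j.castSucc * M p j.castSucc

/-- `M ← (i_1, j_1) ← ⋯ ← (i_k, j_k)`. -/
def pivots {n r : ℕ} (M : Matrix (Fin (n + r)) (Fin (n + 1)) ℚ) (l : List (Fin r × Fin n)) :
    Matrix (Fin (n + r)) (Fin (n + 1)) ℚ :=
  l.foldl (fun N p => pivot N p.1 p.2) M

/-- All pivot items met in `M ← (i_1, j_1) ← ⋯ ← (i_k, j_k)` are nonzero. -/
def PivotsNeZero {n r : ℕ} :
    Matrix (Fin (n + r)) (Fin (n + 1)) ℚ → List (Fin r × Fin n) → Prop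
  | _, [] => True
  | M, p :: l => M (lamIdx n p.1) p.2.castSucc ≠ 0 ∧ PivotsNeZero (pivot M p.1 p.2) l

/-- The sequence of pivot positions `(i_1, j_1), …, (i_r, j_r)` is legitimate for the system
`A α = b`: no row and no column is used twice, and every pivot item is nonzero. -/
structure PivotSequence {n r : ℕ} (A : Matrix (Fin r) (Fin n) ℤ) (b : Fin r → ℤ)
    (i : Fin r → Fin r) (j : Fin r → Fin n) : Prop where
  rows_inj : Function.Injective i
  cols_inj : Function.Injective j
  pivots_ne : PivotsNeZero (systemMatrix A b) (List.ofFn fun k => (i k, j k))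

/-- The matrix `M ← ((i_1, …, i_r); (j_1, …, j_r))` for the system `A α = b`, restricted to its
first `n` rows (the rows of the `λ`'s are ignored). -/
def pivotedMatrix {n r : ℕ} (A : Matrix (Fin r) (Fin n) ℤ) (b : Fin r → ℤ)
    (i : Fin r → Fin r) (j : Fin r → Fin n) : Matrix (Fin n) (Fin (n + 1)) ℚ :=
  Matrix.of fun p s => pivots (systemMatrix A b) (List.ofFn fun k => (i k, j k)) (yIdx r p) s

/-- The columns of `N` with index in `[n]` outside `J`, as vectors in `ℝ^n`. -/
def coneGens {n : ℕ} (N : Matrix (Fin n) (Fin (n + 1)) ℚ) (J : Finset (Fin n)) :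
    {s : Fin n // s ∉ J} → Fin n → ℝ :=
  fun s p => (N p s.1.castSucc : ℝ)

/-- The last column of `N`, as a vector in `ℝ^n`. -/
def coneVertex {n : ℕ} (N : Matrix (Fin n) (Fin (n + 1)) ℚ) : Fin n → ℝ :=
  fun p => (N p (Fin.last n) : ℝ)

/-- The shifted cone `v + {∑ k_s w_s : k_s ≥ 0}`. -/
def shiftedCone {n : ℕ} {ι : Type} [Fintype ι] (w : ι → Fin n → ℝ) (v : Fin n → ℝ) :
    Set (Fin n → ℝ) :=
  {x | ∃ k : ι → ℝ, (∀ s, 0 ≤ k s) ∧ x = v + ∑ s, k s • w s}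

/-- The coefficient of `y^α` in the formal lattice point generating function
`σ_S(y) = ∑_{α ∈ S ∩ ℤ^n} y^α`. -/
def latticeCoeff {n : ℕ} (S : Set (Fin n → ℝ)) (α : Fin n → ℤ) : ℂ :=
  Set.indicator S (fun _ => (1 : ℂ)) (fun p => (α p : ℝ))

/-- A Laurent polynomial in `y`, as an element of the field of fractional series in `y, Λ`. -/
def laurentY {n : ℕ} (r : ℕ) (P : (Fin n → ℤ) →₀ ℂ) : FracSeries n r :=
  P.sum fun α a => mono (Fin.append (fun p => (α p : ℚ)) 0) a

/-- `R` is the rational function of the lattice point generating function `σ_S(y)`: there are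
Laurent polynomials `P` and `Q ≠ 0` in `y` with `Q · σ_S = P` as formal (two-sided infinite)
series, and `R = P / Q`. -/
def IsLatticeGF {n r : ℕ} (S : Set (Fin n → ℝ)) (R : FracSeries n r) : Prop :=
  ∃ P Q : (Fin n → ℤ) →₀ ℂ, Q ≠ 0 ∧
    (∀ β : Fin n → ℤ, (Q.sum fun κ a => a * latticeCoeff S (β - κ)) = P β) ∧
    R = laurentY r P / laurentY r Q

end ConstantTerm

/-!
The denominators of the functions met here are products of binomials `1 - u`, so the constant term
`CT_{λ_i, j}` is a substitution followed by the projection `Z_{y_j}`, and each step of the iterated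
constant term is one step of a Gaussian column elimination.

*The constant term is a function* (`IsCT.unique`).  A linear relation between admissible functions
is first split according to the factor `1 - u_j λ_i^{b_j}`: the rest of each function is free of
`y_j`, so partial fractions in `y_j` are unique (`sum_filter_div_eq_zero`, where solving
`u_j λ_i^{b_j} = 1` for `y_j` separates the factors).  Within one group the substitution for `λ_i`
is a single ring homomorphism, so it preserves the relation (`EForm.sum_ct_eq_zero`).

*One step* (`isCT_eratRest`).  The iterates have the form `Z(F)`, where `F` is `[M]` without the
factors of the used columns and `Z` keeps the integral exponents of all `y`.  This `Z(F)` is the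
average of the conjugates of `F` under roots of unity, that is of its twists by characters of the
exponent group (`expProj_eq_average`), and these twists are of the admissible form.  The
substitution turns a twist of `F` into a twist of the pivoted function (`eratForm_ct`).  The
principal branch of the power and the branch given by the character differ by a character of the
exponent of `y_j` that is trivial on `ℤ`, so `Z_{y_j}` does not see the difference.

*The end of the elimination.*  After `r` pivots the `λ`-rows vanish outside the pivot columns `J`.
The rows and columns outside `J` always form an identity block, so a point `v + ∑ k_s w_s` has
`k_s` as its `s`-th coordinate.  Hence the lattice points of the cone are the integral points
`v + ∑ k_s w_s` with natural numbers `k_s`.  With `D` a common denominator of the `w_s`,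
multiplication by `∏ (1 - y^{D w_s})` leaves the Laurent polynomial of the integral points with all
`k_s < D`, both for the formal generating function (`laurentAction_prod_boxPoints`) and for `Z(F)`,
whatever the directions of expansion (`isLatticeGF_eratRest`).

*Sign and uniqueness of the columns.*  Column operations preserve the minor of `A` with the pivot
rows and columns and turn it into the product of the pivot items (`sign_det_eq_pivotSign`).  A final
column `x` outside `J` satisfies `A x = 0`, or `A x = b` for the vertex, and has prescribed entries
outside `J`; the minor is nonzero, so `x` is determined by `J` (`PivotSequence.column_eq`).
-/

/-! ### Monomials and substitutions -/

theorem mono_mul {n r : ℕ} (κ μ : Fin (n + r) → ℚ) (a b : ℂ) :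
    mono κ a * mono μ b = mono (κ + μ) (a * b) := by
  simp [mono, HahnSeries.single_mul_single]

theorem mono_zero_one {n r : ℕ} : (mono 0 1 : FracSeries n r) = 1 := rfl

theorem mono_coef_zero {n r : ℕ} (κ : Fin (n + r) → ℚ) : mono κ (0 : ℂ) = 0 := by simp [mono]

theorem mono_add {n r : ℕ} (κ : Fin (n + r) → ℚ) (a b : ℂ) :
    mono κ (a + b) = mono κ a + mono κ b := by simp [mono]

theorem smul_mono {n r : ℕ} (κ : Fin (n + r) → ℚ) (a b : ℂ) :
    a • mono κ b = mono κ (a * b) := by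
  rw [mono, mono]
  ext μ
  simp [HahnSeries.coeff_single]

theorem mono_eq_one_iff {n r : ℕ} (κ : Fin (n + r) → ℚ) (a : ℂ) :
    mono κ a = 1 ↔ κ = 0 ∧ a = 1 := by
  constructor
  · intro h
    have ha : a ≠ 0 := by
      rintro rfl
      rw [mono_coef_zero] at h
      exact zero_ne_one h
    rw [← mono_zero_one, mono, mono] at h
    have h0 := congrArg (fun F => HahnSeries.coeff F (toLex κ)) h
    have hκ : κ = 0 := by
      by_contra hne
      have : toLex κ ≠ toLex 0 := fun h => hne (toLex.injective h)
      simp only [HahnSeries.coeff_single_same, HahnSeries.coeff_single_of_ne this] at h0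
      exact ha h0
    subst hκ
    simp only [HahnSeries.coeff_single_same] at h0
    exact ⟨rfl, h0⟩
  · rintro ⟨rfl, rfl⟩
    exact mono_zero_one

/-- The substitution homomorphism `c z^κ ↦ c χ(κ) z^{g(κ)}` from fractional Laurent polynomials
to series, for an additive map `g` of exponents and a character `χ` of the exponent group. -/
noncomputable def laurentSubst {n r : ℕ} (g : (Fin (n + r) → ℚ) →+ (Fin (n + r) → ℚ))
    (χ : AddChar (Fin (n + r) → ℚ) ℂ) :
    AddMonoidAlgebra ℂ (Fin (n + r) → ℚ) →ₐ[ℂ] FracSeries n r :=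
  AddMonoidAlgebra.lift ℂ (FracSeries n r) (Fin (n + r) → ℚ)
    { toFun := fun κ => mono (g κ.toAdd) (χ κ.toAdd)
      map_one' := by simp [mono_zero_one]
      map_mul' := fun κ μ => by simp [mono_mul, AddChar.map_add_eq_mul] }

theorem laurentSubst_single {n r : ℕ} (g : (Fin (n + r) → ℚ) →+ (Fin (n + r) → ℚ))
    (χ : AddChar (Fin (n + r) → ℚ) ℂ) (κ : Fin (n + r) → ℚ) (a : ℂ) :
    laurentSubst g χ (AddMonoidAlgebra.single κ a) = mono (g κ) (a * χ κ) := by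
  simp [laurentSubst, smul_mono]

theorem laurentSubst_ofCoeff {n r : ℕ} (g : (Fin (n + r) → ℚ) →+ (Fin (n + r) → ℚ))
    (χ : AddChar (Fin (n + r) → ℚ) ℂ) (L : FracLaurent n r) :
    laurentSubst g χ (AddMonoidAlgebra.ofCoeff L) = L.sum fun κ a => mono (g κ) (a * χ κ) := by
  simp [laurentSubst, AddMonoidAlgebra.lift_apply, smul_mono]

/-- A fractional Laurent polynomial as a series, as an algebra homomorphism. -/
noncomputable def laurentSeries {n r : ℕ} :
    AddMonoidAlgebra ℂ (Fin (n + r) → ℚ) →ₐ[ℂ] FracSeries n r :=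
  laurentSubst (AddMonoidHom.id _) 1

theorem laurentSeries_single {n r : ℕ} (κ : Fin (n + r) → ℚ) (a : ℂ) :
    laurentSeries (AddMonoidAlgebra.single κ a) = mono κ a := by
  simp [laurentSeries, laurentSubst_single]

theorem laurentSeries_ofCoeff {n r : ℕ} (L : FracLaurent n r) :
    laurentSeries (AddMonoidAlgebra.ofCoeff L) = L.toSeries := by
  simp [laurentSeries, laurentSubst_ofCoeff, FracLaurent.toSeries]

theorem coeff_toSeries {n r : ℕ} (L : FracLaurent n r) (κ : Fin (n + r) → ℚ) :
    L.toSeries.coeff (toLex κ) = L κ := by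
  classical
  induction L using Finsupp.induction_linear with
  | zero => simp [FracLaurent.toSeries]
  | add f g hf hg =>
    have : FracLaurent.toSeries (f + g) = FracLaurent.toSeries f + FracLaurent.toSeries g :=
      Finsupp.sum_add_index' (fun κ => mono_coef_zero κ) (fun κ a b => mono_add κ a b)
    rw [this, HahnSeries.coeff_add, hf, hg, Finsupp.add_apply]
  | single μ a =>
    rw [FracLaurent.toSeries, Finsupp.sum_single_index (mono_coef_zero μ), mono]
    by_cases h : μ = κ
    · subst h; simp
    · rw [HahnSeries.coeff_single_of_ne (fun h' => h (toLex.injective h'.symm)),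
        Finsupp.single_eq_of_ne (fun h' => h h'.symm)]

theorem laurentSeries_injective {n r : ℕ} :
    Function.Injective (laurentSeries : _ →ₐ[ℂ] FracSeries n r) := by
  intro x y h
  have h' : FracLaurent.toSeries (AddMonoidAlgebra.coeff x) =
      FracLaurent.toSeries (AddMonoidAlgebra.coeff y) := by
    rw [← laurentSeries_ofCoeff, ← laurentSeries_ofCoeff]; exact h
  have : AddMonoidAlgebra.coeff x = AddMonoidAlgebra.coeff y := by
    ext κ
    rw [← coeff_toSeries (n := n) (r := r), h', coeff_toSeries]
  exact AddMonoidAlgebra.coeffEquiv.injective this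

/-- The character `κ ↦ c^{ℓ(κ)}`, with the principal branch of the power. -/
noncomputable def cpowChar {V : Type*} [AddMonoid V] (c : ℂ) (hc : c ≠ 0) (l : V →+ ℚ) :
    AddChar V ℂ where
  toFun κ := c ^ ((l κ : ℚ) : ℂ)
  map_zero_eq_one' := by simp
  map_add_eq_mul' κ μ := by
    rw [map_add, Rat.cast_add, Complex.cpow_add _ _ hc]

/-- The additive map `κ ↦ κ - ℓ(κ) e` of exponent vectors. It is the effect on monomials of
solving `c z^e = 1` for a variable: if `ℓ(e) = 1`, it sends `e` to `0`. -/
def elimExp {V : Type*} [AddCommGroup V] [Module ℚ V] (l : V →+ ℚ) (e : V) : V →+ V where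
  toFun κ := κ - l κ • e
  map_zero' := by simp
  map_add' κ μ := by rw [map_add, add_smul]; abel

/-- The substitution homomorphism that makes the monomial `c z^e` equal to `1`, along a linear
functional `ℓ` with `ℓ(e) = 1`. -/
noncomputable def monoElim {n r : ℕ} (l : (Fin (n + r) → ℚ) →+ ℚ) (e : Fin (n + r) → ℚ) (c : ℂ)
    (hc : c ≠ 0) : AddMonoidAlgebra ℂ (Fin (n + r) → ℚ) →ₐ[ℂ] FracSeries n r :=
  laurentSubst (elimExp l e) (cpowChar c hc (-l))

theorem monoElim_single {n r : ℕ} (l : (Fin (n + r) → ℚ) →+ ℚ) (e : Fin (n + r) → ℚ) (c : ℂ)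
    (hc : c ≠ 0) (κ : Fin (n + r) → ℚ) (a : ℂ) :
    monoElim l e c hc (AddMonoidAlgebra.single κ a) =
      mono (κ - l κ • e) (a * c ^ ((-l κ : ℚ) : ℂ)) := by
  rw [monoElim, laurentSubst_single]; rfl

theorem sum_div_map_eq {R K ι : Type*} [CommRing R] [Field K] [DecidableEq ι] (f : R →+* K)
    (s : Finset ι) (a d : ι → R) (hf : ∀ k ∈ s, f (d k) ≠ 0) :
    ∑ k ∈ s, f (a k) / f (d k) =
      f (∑ k ∈ s, a k * ∏ m ∈ s.erase k, d m) / f (∏ m ∈ s, d m) := by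
  have hp : f (∏ m ∈ s, d m) ≠ 0 := by
    rw [map_prod]; exact Finset.prod_ne_zero_iff.mpr hf
  rw [eq_div_iff hp, Finset.sum_mul, map_sum]
  refine Finset.sum_congr rfl fun k hk => ?_
  rw [← Finset.mul_prod_erase s d hk, map_mul, map_mul, ← mul_assoc,
    div_mul_cancel₀ _ (hf k hk)]

/-- Clearing denominators: a linear relation between fractions with denominators outside the
kernel of `φ` is preserved by `φ`. -/
theorem sum_div_map_eq_zero {R K K' ι : Type*} [CommRing R] [Field K] [Field K'] (τ : R →+* K)
    (hτ : Function.Injective τ) (φ : R →+* K') (s : Finset ι) (a d : ι → R)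
    (hd : ∀ k ∈ s, φ (d k) ≠ 0) (h : ∑ k ∈ s, τ (a k) / τ (d k) = 0) :
    ∑ k ∈ s, φ (a k) / φ (d k) = 0 := by
  classical
  have hd' : ∀ k ∈ s, τ (d k) ≠ 0 := fun k hk h0 => hd k hk (by
    rw [(map_eq_zero_iff τ hτ).mp h0, map_zero])
  rw [sum_div_map_eq τ s a d hd', div_eq_zero_iff, map_eq_zero_iff τ hτ, map_prod,
    Finset.prod_eq_zero_iff] at h
  rw [sum_div_map_eq φ s a d hd]
  rcases h with h | ⟨k, hk, h0⟩
  · rw [h, map_zero, zero_div]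
  · exact absurd h0 (hd' k hk)

/-! ### Partial fractions -/

/-- Uniqueness of partial fractions: in a linear relation between fractions `a / (d (1 - Y))`, the
terms with a given `Y = Y₀` cancel after removal of `1 - Y`, if some `ψ` with `ψ Y₀ = 1` separates
`Y₀` from the other `Y` and does not affect `a` and `d`. -/
theorem sum_filter_div_eq_zero {R K ι : Type*} [CommRing R] [DecidableEq R] [Field K]
    (τ ψ : R →+* K) (hτ : Function.Injective τ) (s : Finset ι) (a d Y : ι → R) (Y₀ : R)
    (hd : ∀ k ∈ s, τ (d k) ≠ 0) (hψa : ∀ k ∈ s, ψ (a k) = τ (a k))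
    (hψd : ∀ k ∈ s, ψ (d k) = τ (d k)) (hY₀ : ψ Y₀ = 1) (hτY₀ : τ Y₀ ≠ 1)
    (hY : ∀ k ∈ s, Y k ≠ Y₀ → ψ (Y k) ≠ 1)
    (h : ∑ k ∈ s, τ (a k) / (τ (d k) * (1 - τ (Y k))) = 0) :
    ∑ k ∈ s with Y k = Y₀, τ (a k) / τ (d k) = 0 := by
  have hne : 1 - τ Y₀ ≠ 0 := sub_ne_zero.mpr (Ne.symm hτY₀)
  -- After multiplication by `1 - Y₀` no denominator is killed by `ψ`, while the terms with
  -- `Y k ≠ Y₀` have acquired the factor `1 - Y₀` in the numerator, which is killed by `ψ`.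
  have h1 : ∑ k ∈ s, τ (if Y k = Y₀ then a k else a k * (1 - Y₀)) /
      τ (if Y k = Y₀ then d k else d k * (1 - Y k)) = 0 := by
    have h2 : (1 - τ Y₀) * ∑ k ∈ s, τ (a k) / (τ (d k) * (1 - τ (Y k))) = 0 := by
      rw [h, mul_zero]
    rw [Finset.mul_sum] at h2
    rw [← h2]
    refine Finset.sum_congr rfl fun k _ => ?_
    split_ifs with hk
    · rw [hk, mul_div_assoc', mul_comm (1 - τ Y₀), mul_div_mul_right _ _ hne]
    · simp only [map_mul, map_sub, map_one]
      ring
  have h3 := sum_div_map_eq_zero τ hτ ψ s _ _ (fun k hk => by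
    split_ifs with hk'
    · rw [hψd k hk]; exact hd k hk
    · rw [map_mul, map_sub, map_one, hψd k hk]
      exact mul_ne_zero (hd k hk) (sub_ne_zero.mpr (Ne.symm (hY k hk hk')))) h1
  refine (Finset.sum_filter _ _).trans (Eq.trans ?_ h3)
  refine Finset.sum_congr rfl fun k hk => ?_
  split_ifs with hk'
  · rw [hψa k hk, hψd k hk]
  · rw [map_mul, map_sub, map_one, hY₀, sub_self, mul_zero, zero_div]

/-! ### Projections to subgroups of exponents -/

open scoped Classical in
/-- The projection of a series to the terms with exponent in a subgroup `Γ`. -/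
noncomputable def expProj {n r : ℕ} (Γ : AddSubgroup (Fin (n + r) → ℚ)) :
    FracSeries n r →ₗ[ℂ] FracSeries n r where
  toFun F :=
    { coeff := fun κ => if ofLex κ ∈ Γ then F.coeff κ else 0
      isPWO_support' := F.isPWO_support.mono fun κ hκ h => hκ (by simp [h]) }
  map_add' F G := by
    ext κ
    simp only [HahnSeries.coeff_add]
    split_ifs <;> simp
  map_smul' c F := by
    ext κ
    simp only [HahnSeries.coeff_smul, RingHom.id_apply]
    split_ifs <;> simp

open scoped Classical in
theorem coeff_expProj {n r : ℕ} (Γ : AddSubgroup (Fin (n + r) → ℚ)) (F : FracSeries n r)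
    (κ : ExpVec n r) : (expProj Γ F).coeff κ = if ofLex κ ∈ Γ then F.coeff κ else 0 := rfl

/-- The exponent vectors that are integral in the coordinate `p`. -/
def integralAt {n r : ℕ} (p : Fin (n + r)) : AddSubgroup (Fin (n + r) → ℚ) where
  carrier := {κ | ∃ m : ℤ, κ p = m}
  zero_mem' := ⟨0, by simp⟩
  add_mem' := by
    rintro a b ⟨m, hm⟩ ⟨k, hk⟩
    exact ⟨m + k, by simp [hm, hk]⟩
  neg_mem' := by
    rintro a ⟨m, hm⟩
    exact ⟨-m, by simp [hm]⟩

theorem Zop_eq_expProj {n r : ℕ} (j : Fin n) (F : FracSeries n r) :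
    Zop j F = expProj (integralAt (yIdx r j)) F := rfl

/-! ### The constant term is a function -/

theorem smul_div_series {n r : ℕ} (c : ℂ) (F G : FracSeries n r) : (c • F) / G = c • (F / G) := by
  rw [div_eq_mul_inv, div_eq_mul_inv]
  exact Algebra.smul_mul_assoc c F G⁻¹

namespace EForm

variable {n r : ℕ}

/-- The numerator, as an element of the group algebra. -/
def numAlg (E : EForm n r) : AddMonoidAlgebra ℂ (Fin (n + r) → ℚ) :=
  AddMonoidAlgebra.ofCoeff E.num

/-- The product of the denominator factors other than the `j`-th one, in the group algebra. -/
noncomputable def denAlg (E : EForm n r) (j : Fin n) : AddMonoidAlgebra ℂ (Fin (n + r) → ℚ) :=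
  ∏ s ∈ Finset.univ.erase j, (1 - AddMonoidAlgebra.single (E.expo s) (E.coef s))

/-- The monomial `u_j λ_i^{b_j}` of the `j`-th denominator factor, in the group algebra. -/
noncomputable def monoAlg (E : EForm n r) (j : Fin n) : AddMonoidAlgebra ℂ (Fin (n + r) → ℚ) :=
  AddMonoidAlgebra.single (E.expo j) (E.coef j)

theorem expo_coef_eq_of_monoAlg_eq {E E₀ : EForm n r} {j : Fin n} (hc : E.coef j ≠ 0)
    (h : E.monoAlg j = E₀.monoAlg j) : E.expo j = E₀.expo j ∧ E.coef j = E₀.coef j := by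
  have h1 : Finsupp.single (E.expo j) (E.coef j) = Finsupp.single (E₀.expo j) (E₀.coef j) :=
    congrArg AddMonoidAlgebra.coeff h
  rcases (Finsupp.single_eq_single_iff _ _ _ _).mp h1 with h2 | h2
  · exact h2
  · exact absurd h2.1 hc

theorem val_eq (E : EForm n r) (j : Fin n) :
    E.val = laurentSeries E.numAlg /
      (laurentSeries (E.denAlg j) * (1 - laurentSeries (E.monoAlg j))) := by
  rw [val, numAlg, laurentSeries_ofCoeff, denAlg, monoAlg, map_prod, laurentSeries_single,
    ← Finset.mul_prod_erase Finset.univ _ (Finset.mem_univ j)]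
  simp only [map_sub, map_one, laurentSeries_single]
  rw [mul_comm (∏ _ ∈ _, _)]

/-- The linear functional `κ ↦ κ_i / b` of the exponent vector. -/
def lamFunctional (n : ℕ) {r : ℕ} (i : Fin r) (b : ℚ) : (Fin (n + r) → ℚ) →+ ℚ where
  toFun κ := κ (lamIdx n i) / b
  map_zero' := by simp
  map_add' κ μ := by simp [add_div]

theorem monoElim_single_lam (E : EForm n r) (i : Fin r) (j : Fin n) (hc : E.coef j ≠ 0)
    (κ : Fin (n + r) → ℚ) (a : ℂ) :
    monoElim (lamFunctional n i (E.lamExp i j)) (E.expo j) (E.coef j) hc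
      (AddMonoidAlgebra.single κ a) = E.substMono i j κ a := by
  rw [monoElim_single]; rfl

theorem ct_eq (E : EForm n r) (i : Fin r) (j : Fin n) (hc : E.coef j ≠ 0) :
    E.ct i j = ((SignType.sign (E.lamExp i j) : ℤ) : FracSeries n r) *
      expProj (integralAt (yIdx r j))
        (monoElim (lamFunctional n i (E.lamExp i j)) (E.expo j) (E.coef j) hc E.numAlg /
          monoElim (lamFunctional n i (E.lamExp i j)) (E.expo j) (E.coef j) hc (E.denAlg j)) := by
  rw [ct, Zop_eq_expProj, denAlg, map_prod]
  simp only [map_sub, map_one, monoElim_single_lam]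
  rw [monoElim, numAlg, laurentSubst_ofCoeff]
  rfl

theorem monoElim_denAlg_ne_zero {E : EForm n r} {i : Fin r} {j : Fin n} (h : E.Admissible i j) :
    monoElim (lamFunctional n i (E.lamExp i j)) (E.expo j) (E.coef j) h.coef_ne
      (E.denAlg j) ≠ 0 := by
  rw [denAlg, map_prod, Finset.prod_ne_zero_iff]
  intro s hs
  rw [map_sub, map_one, monoElim_single_lam]
  exact h.coprime s (Finset.ne_of_mem_erase hs)

theorem laurentSeries_denAlg_ne_zero {E : EForm n r} {i : Fin r} {j : Fin n}
    (h : E.Admissible i j) : laurentSeries (E.denAlg j) ≠ 0 := by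
  intro h0
  apply monoElim_denAlg_ne_zero h
  rw [(map_eq_zero_iff _ laurentSeries_injective).mp h0, map_zero]

/-- The functional that reads off the exponent of `y_j`. -/
def yFunctional (r : ℕ) {n : ℕ} (j : Fin n) : (Fin (n + r) → ℚ) →+ ℚ :=
  Pi.evalAddMonoidHom (fun _ => ℚ) (yIdx r j)

theorem yFunctional_apply (j : Fin n) (κ : Fin (n + r) → ℚ) :
    yFunctional r j κ = κ (yIdx r j) := rfl

theorem monoElim_y_single {j : Fin n} {e : Fin (n + r) → ℚ} {c : ℂ} (hc : c ≠ 0)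
    {κ : Fin (n + r) → ℚ} {a : ℂ} (h : a = 0 ∨ κ (yIdx r j) = 0) :
    monoElim (yFunctional r j) e c hc (AddMonoidAlgebra.single κ a) = mono κ a := by
  rw [monoElim_single, yFunctional_apply]
  rcases h with rfl | h
  · simp [mono_coef_zero]
  · simp [h]

theorem monoElim_y_numAlg {E : EForm n r} {i : Fin r} {j : Fin n} (h : E.Admissible i j)
    {e : Fin (n + r) → ℚ} {c : ℂ} (hc : c ≠ 0) :
    monoElim (yFunctional r j) e c hc E.numAlg = laurentSeries E.numAlg := by
  rw [monoElim, numAlg, laurentSubst_ofCoeff, laurentSeries_ofCoeff, FracLaurent.toSeries]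
  refine Finsupp.sum_congr fun κ hκ => ?_
  rw [← laurentSubst_single]
  exact monoElim_y_single hc (Or.inr (h.y_num κ hκ))

theorem monoElim_y_denAlg {E : EForm n r} {i : Fin r} {j : Fin n} (h : E.Admissible i j)
    {e : Fin (n + r) → ℚ} {c : ℂ} (hc : c ≠ 0) :
    monoElim (yFunctional r j) e c hc (E.denAlg j) = laurentSeries (E.denAlg j) := by
  rw [denAlg, map_prod, map_prod]
  refine Finset.prod_congr rfl fun s hs => ?_
  rw [map_sub, map_sub, map_one, map_one, laurentSeries_single,
    monoElim_y_single hc (h.y_other s (Finset.ne_of_mem_erase hs))]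

theorem monoElim_y_monoAlg_eq_one_iff {E E₀ : EForm n r} {i : Fin r} {j : Fin n}
    (h : E.Admissible i j) (h₀ : E₀.Admissible i j) :
    monoElim (yFunctional r j) (E₀.expo j) (E₀.coef j) h₀.coef_ne (E.monoAlg j) = 1 ↔
      E.monoAlg j = E₀.monoAlg j := by
  have hc := h₀.coef_ne
  rw [monoAlg, monoElim_single, mono_eq_one_iff, yFunctional_apply, h.y_self, one_smul, sub_eq_zero]
  have hpow : (E₀.coef j) ^ (((-1 : ℚ)) : ℂ) = (E₀.coef j)⁻¹ := by
    rw [Rat.cast_neg, Rat.cast_one, Complex.cpow_neg_one]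
  rw [hpow, mul_inv_eq_one₀ hc]
  constructor
  · rintro ⟨h1, h2⟩
    rw [monoAlg, h1, h2]
  · intro h1
    exact expo_coef_eq_of_monoAlg_eq h.coef_ne h1

/-- A linear relation between functions of the admissible form is preserved by the constant term. -/
theorem sum_ct_eq_zero {ι : Type*} {i : Fin r} {j : Fin n} (s : Finset ι) (E : ι → EForm n r)
    (hE : ∀ k ∈ s, (E k).Admissible i j) (h : ∑ k ∈ s, (E k).val = 0) :
    ∑ k ∈ s, (E k).ct i j = 0 := by
  classical
  -- Group the terms according to the factor `1 - u_j λ_i^{b_j}`.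
  rw [← Finset.sum_fiberwise_of_maps_to (s := s) (t := s.image fun k => (E k).monoAlg j)
    (g := fun k => (E k).monoAlg j) (fun k hk => Finset.mem_image_of_mem _ hk)]
  refine Finset.sum_eq_zero fun Y hY => ?_
  obtain ⟨k₀, hk₀, rfl⟩ := Finset.mem_image.mp hY
  have h₀ := hE k₀ hk₀
  have hsame : ∀ k ∈ s.filter (fun k => (E k).monoAlg j = (E k₀).monoAlg j),
      (E k).expo j = (E k₀).expo j ∧ (E k).coef j = (E k₀).coef j := by
    intro k hk
    rw [Finset.mem_filter] at hk
    exact expo_coef_eq_of_monoAlg_eq (hE k hk.1).coef_ne hk.2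
  have h1 : ∑ k ∈ s with (E k).monoAlg j = (E k₀).monoAlg j,
      laurentSeries (E k).numAlg / laurentSeries ((E k).denAlg j) = 0 := by
    refine sum_filter_div_eq_zero (laurentSeries : _ →ₐ[ℂ] FracSeries n r).toRingHom
      (monoElim (yFunctional r j) ((E k₀).expo j) ((E k₀).coef j) h₀.coef_ne).toRingHom
      laurentSeries_injective s _ _ (fun k => (E k).monoAlg j) _
      (fun k hk => laurentSeries_denAlg_ne_zero (hE k hk))
      (fun k hk => monoElim_y_numAlg (hE k hk) h₀.coef_ne)
      (fun k hk => monoElim_y_denAlg (hE k hk) h₀.coef_ne)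
      ((monoElim_y_monoAlg_eq_one_iff h₀ h₀).mpr rfl) ?_
      (fun k hk hne h1 => hne ((monoElim_y_monoAlg_eq_one_iff (hE k hk) h₀).mp h1)) ?_
    · intro h1
      have h2 := ((mono_eq_one_iff _ _).mp ((laurentSeries_single _ _).symm.trans h1)).1
      have h3 := h₀.y_self
      rw [h2] at h3
      exact zero_ne_one h3
    · rw [← h]
      exact Finset.sum_congr rfl fun k _ => ((E k).val_eq j).symm
  -- Within the group all terms undergo the same substitution for `λ_i`, with the same `b_j`.
  have hlam : ∀ k ∈ s.filter (fun k => (E k).monoAlg j = (E k₀).monoAlg j),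
      (E k).lamExp i j = (E k₀).lamExp i j := fun k hk => by
    rw [lamExp, lamExp, (hsame k hk).1]
  have helim : ∀ k, ∀ hk : k ∈ s.filter (fun k => (E k).monoAlg j = (E k₀).monoAlg j),
      monoElim (lamFunctional n i ((E k).lamExp i j)) ((E k).expo j) ((E k).coef j)
        (hE k (Finset.mem_filter.mp hk).1).coef_ne =
      monoElim (lamFunctional n i ((E k₀).lamExp i j)) ((E k₀).expo j) ((E k₀).coef j)
        h₀.coef_ne := by
    intro k hk
    simp only [hlam k hk, (hsame k hk).1, (hsame k hk).2]
  have h2 := sum_div_map_eq_zero (laurentSeries : _ →ₐ[ℂ] FracSeries n r).toRingHom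
    laurentSeries_injective
    (monoElim (lamFunctional n i ((E k₀).lamExp i j)) ((E k₀).expo j) ((E k₀).coef j)
      h₀.coef_ne).toRingHom _ (fun k => (E k).numAlg) (fun k => (E k).denAlg j)
    (fun k hk => by
      have := monoElim_denAlg_ne_zero (hE k (Finset.mem_filter.mp hk).1)
      rw [helim k hk] at this
      exact this) h1
  calc _ = ∑ k ∈ s with (E k).monoAlg j = (E k₀).monoAlg j,
        ((SignType.sign ((E k₀).lamExp i j) : ℤ) : FracSeries n r) *
        expProj (integralAt (yIdx r j))
        (monoElim (lamFunctional n i ((E k₀).lamExp i j)) ((E k₀).expo j) ((E k₀).coef j)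
            h₀.coef_ne (E k).numAlg /
          monoElim (lamFunctional n i ((E k₀).lamExp i j)) ((E k₀).expo j) ((E k₀).coef j)
            h₀.coef_ne ((E k).denAlg j)) := by
        refine Finset.sum_congr rfl fun k hk => ?_
        rw [ct_eq _ _ _ (hE k (Finset.mem_filter.mp hk).1).coef_ne, helim k hk, hlam k hk]
    _ = 0 := by
        rw [← Finset.mul_sum, ← map_sum]
        -- `h2` is about the underlying ring homomorphisms of the algebra homomorphisms here.
        erw [h2]
        rw [map_zero, mul_zero]

/-- Multiplication of the numerator by a scalar. -/
noncomputable def scale (c : ℂ) (E : EForm n r) : EForm n r where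
  num := c • E.num
  coef := E.coef
  expo := E.expo

theorem scale_numAlg (c : ℂ) (E : EForm n r) : (E.scale c).numAlg = c • E.numAlg := rfl

theorem scale_val (c : ℂ) (E : EForm n r) : (E.scale c).val = c • E.val := by
  rw [val, val, ← laurentSeries_ofCoeff, ← laurentSeries_ofCoeff]
  change laurentSeries (c • E.numAlg) / _ = _
  rw [map_smul, smul_div_series]
  rfl

theorem scale_ct (c : ℂ) (E : EForm n r) (i : Fin r) (j : Fin n) (hc : E.coef j ≠ 0) :
    (E.scale c).ct i j = c • E.ct i j := by
  rw [ct_eq _ _ _ hc, ct_eq (E.scale c) _ _ hc, scale_numAlg, map_smul, smul_div_series, map_smul]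
  exact Algebra.mul_smul_comm c _ _

theorem Admissible.scale {E : EForm n r} {i : Fin r} {j : Fin n} (h : E.Admissible i j) (c : ℂ) :
    (E.scale c).Admissible i j where
  coef_ne := h.coef_ne
  lam_ne := h.lam_ne
  y_self := h.y_self
  y_other := h.y_other
  y_num := fun κ hκ => h.y_num κ (Finsupp.support_smul hκ)
  coprime := h.coprime

end EForm

theorem IsCT.unique {n r : ℕ} {i : Fin r} {j : Fin n} {F R R' : FracSeries n r}
    (h : IsCT i j F R) (h' : IsCT i j F R') : R = R' := by
  obtain ⟨l, hl, hF, rfl⟩ := h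
  obtain ⟨l', hl', hF', rfl⟩ := h'
  -- The two decompositions of `F` combine to a linear relation.
  have hL : ∀ E ∈ l ++ l'.map (EForm.scale (-1)), E.Admissible i j := by
    intro E hE
    rcases List.mem_append.mp hE with hE | hE
    · exact hl E hE
    · obtain ⟨E', hE', rfl⟩ := List.mem_map.mp hE
      exact (hl' E' hE').scale _
  have hct : (l'.map ((fun E => E.ct i j) ∘ EForm.scale (-1))).sum =
      -(l'.map fun E => E.ct i j).sum := by
    rw [List.sum_neg, List.map_map]
    refine congrArg List.sum (List.map_congr_left fun E hE => ?_)
    exact (EForm.scale_ct _ _ _ _ (hl' E hE).coef_ne).trans (neg_one_smul ℂ (E.ct i j))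
  have hval : (l'.map (EForm.val ∘ EForm.scale (-1))).sum = -(l'.map EForm.val).sum := by
    rw [List.sum_neg, List.map_map]
    refine congrArg List.sum (List.map_congr_left fun E hE => ?_)
    exact (EForm.scale_val _ _).trans (neg_one_smul ℂ E.val)
  generalize hL' : l ++ l'.map (EForm.scale (-1)) = L at hL
  have key := EForm.sum_ct_eq_zero (i := i) (j := j) Finset.univ
    (fun k : Fin L.length => L[(k : ℕ)]) (fun k _ => hL _ (List.getElem_mem _)) (by
      rw [Fin.sum_univ_fun_getElem L EForm.val, ← hL', List.map_append, List.sum_append,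
        List.map_map, hval, ← hF, ← hF', add_neg_cancel])
  rw [Fin.sum_univ_fun_getElem L (fun E => E.ct i j), ← hL', List.map_append, List.sum_append,
    List.map_map, hct, add_neg_eq_zero] at key
  exact key

theorem IsIterCT.unique {n r : ℕ} {l : List (Fin r × Fin n)} {F R R' : FracSeries n r}
    (h : IsIterCT l F R) (h' : IsIterCT l F R') : R = R' := by
  induction l generalizing F with
  | nil => exact Eq.trans h h'.symm
  | cons p l ih =>
    obtain ⟨G, hG, h⟩ := h
    obtain ⟨G', hG', h'⟩ := h'
    rw [hG'.unique hG] at h'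
    exact ih h h'

theorem IsCT.smul {n r : ℕ} {i : Fin r} {j : Fin n} {F R : FracSeries n r} (c : ℂ)
    (h : IsCT i j F R) : IsCT i j (c • F) (c • R) := by
  obtain ⟨l, hl, rfl, rfl⟩ := h
  refine ⟨l.map (EForm.scale c), ?_, ?_, ?_⟩
  · intro E hE
    obtain ⟨E', hE', rfl⟩ := List.mem_map.mp hE
    exact (hl E' hE').scale _
  · rw [List.map_map, List.smul_sum, List.map_map]
    exact congrArg List.sum (List.map_congr_left fun E _ => (EForm.scale_val c E).symm)
  · rw [List.map_map, List.smul_sum, List.map_map]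
    exact congrArg List.sum
      (List.map_congr_left fun E hE => (EForm.scale_ct c E i j (hl E hE).coef_ne).symm)

theorem IsIterCT.smul {n r : ℕ} {l : List (Fin r × Fin n)} {F R : FracSeries n r} (c : ℂ)
    (h : IsIterCT l F R) : IsIterCT l (c • F) (c • R) := by
  induction l generalizing F with
  | nil => exact congrArg (c • ·) h
  | cons p l ih =>
    obtain ⟨G, hG, h⟩ := h
    exact ⟨_, hG.smul c, ih h⟩

/-! ### Twists by characters and averages over roots of unity -/

/-- The series that commute with the projection to exponents in `Γ`. -/
noncomputable def expScalars {n r : ℕ} (Γ : AddSubgroup (Fin (n + r) → ℚ)) :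
    Subring (FracSeries n r) where
  carrier := {H | ∀ F, expProj Γ (H * F) = H * expProj Γ F}
  zero_mem' F := by simp
  one_mem' F := by simp
  add_mem' {a b} ha hb F := by
    rw [add_mul, map_add, ha F, hb F, add_mul]
  neg_mem' {a} ha F := by
    have h1 : -a * F = -(a * F) := neg_mul a F
    have h2 : -a * expProj Γ F = -(a * expProj Γ F) := neg_mul a _
    rw [h1, h2, map_neg, ha F]
  mul_mem' {a b} ha hb F := by
    rw [mul_assoc, ha, hb, mul_assoc]

theorem mono_mem_expScalars {n r : ℕ} {Γ : AddSubgroup (Fin (n + r) → ℚ)} {κ : Fin (n + r) → ℚ}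
    (hκ : κ ∈ Γ) (a : ℂ) : mono κ a ∈ expScalars Γ := by
  intro F
  ext μ
  obtain ⟨ν, rfl⟩ : ∃ ν, μ = ν + toLex κ := ⟨μ - toLex κ, by abel⟩
  rw [coeff_expProj, mono, HahnSeries.coeff_single_mul_add, HahnSeries.coeff_single_mul_add,
    coeff_expProj]
  have : ofLex (ν + toLex κ) ∈ Γ ↔ ofLex ν ∈ Γ := by
    rw [ofLex_add, ofLex_toLex]
    exact Γ.add_mem_cancel_right hκ
  by_cases h : ofLex ν ∈ Γ
  · rw [if_pos h, if_pos (this.mpr h)]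
  · rw [if_neg h, if_neg (fun h' => h (this.mp h')), mul_zero]

theorem one_sub_mono_mem_expScalars {n r : ℕ} {Γ : AddSubgroup (Fin (n + r) → ℚ)}
    {κ : Fin (n + r) → ℚ} {a : ℂ} (hκ : a = 0 ∨ κ ∈ Γ) : 1 - mono κ a ∈ expScalars Γ := by
  refine Subring.sub_mem _ (Subring.one_mem _) ?_
  rcases hκ with rfl | hκ
  · rw [mono_coef_zero]; exact Subring.zero_mem _
  · exact mono_mem_expScalars hκ a

open scoped Classical in
theorem expProj_mono {n r : ℕ} (Γ : AddSubgroup (Fin (n + r) → ℚ)) (κ : Fin (n + r) → ℚ) (a : ℂ) :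
    expProj Γ (mono κ a) = if κ ∈ Γ then mono κ a else 0 := by
  ext μ
  rw [coeff_expProj]
  by_cases h : μ = toLex κ
  · rw [h, ofLex_toLex]
    split_ifs <;> simp
  · have h0 : (mono κ a).coeff μ = 0 := HahnSeries.coeff_single_of_ne h
    rw [h0]
    split_ifs <;> simp [h0]

theorem expProj_div {n r : ℕ} {Γ : AddSubgroup (Fin (n + r) → ℚ)} {F G : FracSeries n r}
    (hG : G ∈ expScalars Γ) : expProj Γ (F / G) = expProj Γ F / G := by
  by_cases h0 : G = 0
  · simp [h0]
  · rw [eq_div_iff h0, mul_comm, ← hG, mul_div_cancel₀ _ h0]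

theorem expProj_expProj_of_le {n r : ℕ} {Γ Δ : AddSubgroup (Fin (n + r) → ℚ)} (h : Γ ≤ Δ)
    (F : FracSeries n r) : expProj Δ (expProj Γ F) = expProj Γ F := by
  ext κ
  simp only [coeff_expProj]
  split_ifs with h1 h2 h2
  · rfl
  · rfl
  · exact absurd (h h2) h1
  · rfl

/-- Multiplication of the coefficient of `z^κ` by `χ(κ)`. -/
def twistFun {n r : ℕ} (χ : AddChar (Fin (n + r) → ℚ) ℂ) (F : FracSeries n r) :
    FracSeries n r where
  coeff κ := χ (ofLex κ) * F.coeff κ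
  isPWO_support' := F.isPWO_support.mono fun κ hκ h => hκ (by
    change χ (ofLex κ) * F.coeff κ = 0
    rw [h, mul_zero])

theorem coeff_twistFun {n r : ℕ} (χ : AddChar (Fin (n + r) → ℚ) ℂ) (F : FracSeries n r)
    (κ : ExpVec n r) : (twistFun χ F).coeff κ = χ (ofLex κ) * F.coeff κ := rfl

theorem AddChar.apply_ne_zero {V : Type*} [AddCommGroup V] (χ : AddChar V ℂ) (κ : V) :
    χ κ ≠ 0 := by
  intro h
  have h1 := AddChar.map_add_eq_mul χ κ (-κ)
  rw [h, zero_mul, add_neg_cancel, AddChar.map_zero_eq_one] at h1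
  exact one_ne_zero h1

/-- The ring endomorphism of the field of series that multiplies the coefficient of `z^κ` by
`χ(κ)`. -/
noncomputable def twist {n r : ℕ} (χ : AddChar (Fin (n + r) → ℚ) ℂ) :
    FracSeries n r →+* FracSeries n r where
  toFun := twistFun χ
  map_one' := by
    ext κ
    rw [coeff_twistFun, HahnSeries.coeff_one]
    split_ifs with h
    · rw [h, ofLex_zero, AddChar.map_zero_eq_one, one_mul]
    · rw [mul_zero]
  map_zero' := by
    ext κ
    rw [coeff_twistFun, HahnSeries.coeff_zero, mul_zero]
  map_add' F G := by
    ext κ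
    rw [HahnSeries.coeff_add, coeff_twistFun, coeff_twistFun, coeff_twistFun, HahnSeries.coeff_add,
      mul_add]
  map_mul' F G := by
    ext κ
    rw [coeff_twistFun, HahnSeries.coeff_mul, HahnSeries.coeff_mul, Finset.mul_sum]
    refine Finset.sum_congr ?_ fun ij hij => ?_
    · ext ij
      simp [Finset.mem_antidiagonal, coeff_twistFun, AddChar.apply_ne_zero]
    · rw [Finset.mem_antidiagonal] at hij
      rw [← hij.2.2, coeff_twistFun, coeff_twistFun, ofLex_add, AddChar.map_add_eq_mul]
      ring

theorem coeff_twist {n r : ℕ} (χ : AddChar (Fin (n + r) → ℚ) ℂ) (F : FracSeries n r)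
    (κ : ExpVec n r) : (twist χ F).coeff κ = χ (ofLex κ) * F.coeff κ := rfl

theorem twist_mono {n r : ℕ} (χ : AddChar (Fin (n + r) → ℚ) ℂ) (κ : Fin (n + r) → ℚ) (a : ℂ) :
    twist χ (mono κ a) = mono κ (χ κ * a) := by
  ext μ
  rw [coeff_twist]
  by_cases h : μ = toLex κ
  · rw [h]
    simp [mono]
  · rw [mono, mono, HahnSeries.coeff_single_of_ne h, HahnSeries.coeff_single_of_ne h, mul_zero]

/-- A projection does not see a twist by a character that is trivial on `Γ`. -/
theorem expProj_twist_mul {n r : ℕ} {Γ : AddSubgroup (Fin (n + r) → ℚ)}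
    (χ ψ : AddChar (Fin (n + r) → ℚ) ℂ) (hψ : ∀ κ ∈ Γ, ψ κ = 1) (F : FracSeries n r) :
    expProj Γ (twist (χ * ψ) F) = expProj Γ (twist χ F) := by
  ext κ
  simp only [coeff_expProj, coeff_twist]
  split_ifs with h
  · rw [AddChar.mul_apply, hψ _ h, mul_one]
  · rfl

/-- The exponent vectors whose `y`-coordinates are in `(1/N) ℤ`, for `N ≠ 0`; the `λ`-coordinates
are arbitrary. -/
def yFractional (n r N : ℕ) : AddSubgroup (Fin (n + r) → ℚ) where
  carrier := {κ | ∀ p : Fin n, ∃ m : ℤ, N * κ (yIdx r p) = m}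
  zero_mem' _ := ⟨0, by simp⟩
  add_mem' {a b} ha hb p := by
    obtain ⟨m, hm⟩ := ha p
    obtain ⟨k, hk⟩ := hb p
    exact ⟨m + k, by rw [Pi.add_apply, mul_add, hm, hk]; push_cast; rfl⟩
  neg_mem' {a} ha p := by
    obtain ⟨m, hm⟩ := ha p
    exact ⟨-m, by rw [Pi.neg_apply, mul_neg, hm]; push_cast; rfl⟩

theorem mem_yFractional {n r N : ℕ} {κ : Fin (n + r) → ℚ} :
    κ ∈ yFractional n r N ↔ ∀ p : Fin n, ∃ m : ℤ, N * κ (yIdx r p) = m := Iff.rfl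

theorem mem_yFractional_one {n r : ℕ} {κ : Fin (n + r) → ℚ} :
    κ ∈ yFractional n r 1 ↔ ∀ p : Fin n, ∃ m : ℤ, κ (yIdx r p) = m := by
  simp [mem_yFractional]

theorem yFractional_one_le (n r : ℕ) (j : Fin n) :
    yFractional n r 1 ≤ integralAt (yIdx r j) := fun _ hκ => mem_yFractional_one.mp hκ j

/-- The character `κ ↦ exp(2πi ∑ k_p κ_p)`, the sum being over the `y`-coordinates. -/
noncomputable def rootChar {n : ℕ} (r : ℕ) (k : Fin n → ℕ) : AddChar (Fin (n + r) → ℚ) ℂ where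
  toFun κ := ∏ p, Complex.exp (2 * Real.pi * Complex.I * (κ (yIdx r p) : ℚ)) ^ k p
  map_zero_eq_one' := by simp
  map_add_eq_mul' κ μ := by
    rw [← Finset.prod_mul_distrib]
    refine Finset.prod_congr rfl fun p _ => ?_
    rw [← mul_pow, ← Complex.exp_add, Pi.add_apply, Rat.cast_add, mul_add]

theorem rootChar_apply {n r : ℕ} (k : Fin n → ℕ) (κ : Fin (n + r) → ℚ) :
    rootChar r k κ = ∏ p, Complex.exp (2 * Real.pi * Complex.I * (κ (yIdx r p) : ℚ)) ^ k p := rfl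

open scoped Classical in
theorem sum_exp_pow {N : ℕ} (q : ℚ) (hq : ∃ m : ℤ, N * q = m) :
    ∑ a : Fin N, Complex.exp (2 * Real.pi * Complex.I * q) ^ (a : ℕ) =
      if ∃ m : ℤ, q = m then (N : ℂ) else 0 := by
  have hone : Complex.exp (2 * Real.pi * Complex.I * q) = 1 ↔ ∃ m : ℤ, q = m := by
    rw [Complex.exp_eq_one_iff]
    refine exists_congr fun m => ?_
    rw [mul_comm, mul_left_inj' Complex.two_pi_I_ne_zero]
    exact_mod_cast Iff.rfl
  rw [Fin.sum_univ_eq_sum_range (fun a => Complex.exp (2 * Real.pi * Complex.I * q) ^ a) N]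
  split_ifs with h
  · simp [hone.mpr h]
  · have hne : Complex.exp (2 * Real.pi * Complex.I * q) ≠ 1 := fun h' => h (hone.mp h')
    rw [geom_sum_eq hne, ← Complex.exp_nat_mul]
    obtain ⟨m, hm⟩ := hq
    have : Complex.exp (N * (2 * Real.pi * Complex.I * q)) = 1 := by
      rw [Complex.exp_eq_one_iff]
      refine ⟨m, ?_⟩
      have hm' : (N : ℂ) * q = m := by exact_mod_cast hm
      rw [← hm']; ring
    rw [this, sub_self, zero_div]

open scoped Classical in
theorem sum_rootChar {n r N : ℕ} {κ : Fin (n + r) → ℚ} (hκ : κ ∈ yFractional n r N) :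
    ∑ k : Fin n → Fin N, rootChar r (fun p => (k p : ℕ)) κ =
      if κ ∈ yFractional n r 1 then (N : ℂ) ^ n else 0 := by
  simp only [rootChar_apply]
  rw [← Fintype.prod_sum (fun (p : Fin n) (a : Fin N) =>
    Complex.exp (2 * Real.pi * Complex.I * (κ (yIdx r p) : ℚ)) ^ (a : ℕ))]
  rw [Finset.prod_congr rfl fun p _ => sum_exp_pow (κ (yIdx r p)) (hκ p), mem_yFractional_one]
  split_ifs with h
  · rw [Finset.prod_congr rfl fun p _ => if_pos (h p)]
    simp
  · push Not at h
    obtain ⟨p, hp⟩ := h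
    refine Finset.prod_eq_zero (Finset.mem_univ p) (if_neg ?_)
    push Not
    exact hp

/-- The projection to integral `y`-exponents is the average of the conjugates under roots of
unity, on series with bounded denominators in the `y`-exponents. -/
theorem expProj_eq_average {n r N : ℕ} (hN : N ≠ 0) {F : FracSeries n r}
    (hF : expProj (yFractional n r N) F = F) :
    expProj (yFractional n r 1) F =
      ((N : ℂ) ^ n)⁻¹ • ∑ k : Fin n → Fin N, twist (rootChar r fun p => (k p : ℕ)) F := by
  ext κ
  rw [HahnSeries.coeff_smul, HahnSeries.coeff_sum]
  simp only [coeff_twist]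
  rw [← Finset.sum_mul, coeff_expProj]
  by_cases hκ : ofLex κ ∈ yFractional n r N
  · rw [sum_rootChar hκ]
    split_ifs with h
    · rw [smul_eq_mul, inv_mul_cancel_left₀ (pow_ne_zero _ (Nat.cast_ne_zero.mpr hN))]
    · simp
  · have : F.coeff κ = 0 := by rw [← hF, coeff_expProj, if_neg hκ]
    simp [this]

/-! ### Constant terms and pivoting -/

/-- The function `[M]` with the denominator factors of the columns in `S` removed, twisted by a
character `χ` of the exponent group: every monomial `z^κ` is replaced by `χ(κ) z^κ`. A removed
factor has the coefficient `0`. -/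
noncomputable def eratForm {n r : ℕ} (M : Matrix (Fin (n + r)) (Fin (n + 1)) ℚ) (S : Finset (Fin n))
    (χ : AddChar (Fin (n + r) → ℚ) ℂ) : EForm n r where
  num := Finsupp.single (fun p => M p (Fin.last n)) (χ fun p => M p (Fin.last n))
  coef s := if s ∈ S then 0 else χ fun p => M p s.castSucc
  expo s p := M p s.castSucc

/-- The function `[M]` with the denominator factors of the columns in `S` removed. -/
noncomputable def eratRest {n r : ℕ} (M : Matrix (Fin (n + r)) (Fin (n + 1)) ℚ)
    (S : Finset (Fin n)) : FracSeries n r :=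
  mono (fun p => M p (Fin.last n)) 1 /
    ∏ s, (1 - mono (fun p => M p s.castSucc) (if s ∈ S then 0 else 1))

theorem erat_eq_eratRest {n r : ℕ} (M : Matrix (Fin (n + r)) (Fin (n + 1)) ℚ) :
    erat M = eratRest M ∅ := by
  simp [erat, eratRest]

theorem eratForm_val {n r : ℕ} (M : Matrix (Fin (n + r)) (Fin (n + 1)) ℚ) (S : Finset (Fin n))
    (χ : AddChar (Fin (n + r) → ℚ) ℂ) : (eratForm M S χ).val = twist χ (eratRest M S) := by
  rw [eratRest, map_div₀, map_prod, twist_mono, EForm.val, mul_one]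
  congr 1
  · rw [FracLaurent.toSeries, eratForm, Finsupp.sum_single_index (mono_coef_zero _)]
  · refine Finset.prod_congr rfl fun s _ => ?_
    rw [map_sub, map_one, twist_mono, eratForm, mul_ite, mul_zero, mul_one]

/-- The shape of the first `n` rows during the elimination, `S` being the set of columns used so
far: the rows and columns outside `S` form an identity block, and the last column vanishes in the
rows outside `S`. -/
structure IsPartlyEliminated {n r : ℕ} (M : Matrix (Fin (n + r)) (Fin (n + 1)) ℚ)
    (S : Finset (Fin n)) : Prop where
  diag : ∀ j ∉ S, M (yIdx r j) j.castSucc = 1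
  offDiag : ∀ j ∉ S, ∀ s ∉ S, s ≠ j → M (yIdx r j) s.castSucc = 0
  last : ∀ j ∉ S, M (yIdx r j) (Fin.last n) = 0

theorem pivot_apply_self {n r : ℕ} (M : Matrix (Fin (n + r)) (Fin (n + 1)) ℚ) (i : Fin r)
    (j : Fin n) (p : Fin (n + r)) : pivot M i j p j.castSucc = M p j.castSucc := by
  simp [pivot]

theorem pivot_apply_of_ne {n r : ℕ} (M : Matrix (Fin (n + r)) (Fin (n + 1)) ℚ) (i : Fin r)
    (j : Fin n) (p : Fin (n + r)) {s : Fin (n + 1)} (h : s ≠ j.castSucc) :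
    pivot M i j p s =
      M p s - M (lamIdx n i) s / M (lamIdx n i) j.castSucc * M p j.castSucc := by
  simp [pivot, h]

theorem pivot_apply_castSucc {n r : ℕ} (M : Matrix (Fin (n + r)) (Fin (n + 1)) ℚ) (i : Fin r)
    (j : Fin n) (p : Fin (n + r)) {s : Fin n} (h : s ≠ j) :
    pivot M i j p s.castSucc =
      M p s.castSucc - M (lamIdx n i) s.castSucc / M (lamIdx n i) j.castSucc * M p j.castSucc :=
  pivot_apply_of_ne M i j p fun h' => h (Fin.castSucc_injective n h')

theorem pivot_apply_last {n r : ℕ} (M : Matrix (Fin (n + r)) (Fin (n + 1)) ℚ) (i : Fin r)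
    (j : Fin n) (p : Fin (n + r)) :
    pivot M i j p (Fin.last n) = M p (Fin.last n) -
      M (lamIdx n i) (Fin.last n) / M (lamIdx n i) j.castSucc * M p j.castSucc :=
  pivot_apply_of_ne M i j p (Fin.castSucc_lt_last j).ne'

theorem IsPartlyEliminated.pivot {n r : ℕ} {M : Matrix (Fin (n + r)) (Fin (n + 1)) ℚ}
    {S : Finset (Fin n)} (h : IsPartlyEliminated M S) (i : Fin r) {j : Fin n} (hj : j ∉ S) :
    IsPartlyEliminated (pivot M i j) (insert j S) where
  diag t ht := by
    rw [Finset.mem_insert, not_or] at ht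
    rw [pivot_apply_castSucc _ _ _ _ ht.1, h.diag t ht.2, h.offDiag t ht.2 j hj (Ne.symm ht.1)]
    simp
  offDiag t ht s hs hst := by
    rw [Finset.mem_insert, not_or] at ht hs
    rw [pivot_apply_castSucc _ _ _ _ hs.1, h.offDiag t ht.2 s hs.2 hst,
      h.offDiag t ht.2 j hj (Ne.symm ht.1)]
    simp
  last t ht := by
    rw [Finset.mem_insert, not_or] at ht
    rw [pivot_apply_last, h.last t ht.2, h.offDiag t ht.2 j hj (Ne.symm ht.1)]
    simp

/-- `[M]` has exponents in any group that contains those of its numerator and its factors. -/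
theorem expProj_eratRest {n r : ℕ} {M : Matrix (Fin (n + r)) (Fin (n + 1)) ℚ} {S : Finset (Fin n)}
    {Γ : AddSubgroup (Fin (n + r) → ℚ)} (hs : ∀ s ∉ S, (fun p => M p s.castSucc) ∈ Γ)
    (hl : (fun p => M p (Fin.last n)) ∈ Γ) : expProj Γ (eratRest M S) = eratRest M S := by
  rw [eratRest, expProj_div, expProj_mono, if_pos hl]
  refine Subring.prod_mem _ fun s _ => one_sub_mono_mem_expScalars ?_
  by_cases h : s ∈ S
  · exact Or.inl (if_pos h)
  · exact Or.inr (hs s h)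

theorem exists_common_denominator {ι : Type*} [Fintype ι] (q : ι → ℚ) :
    ∃ N : ℕ, N ≠ 0 ∧ ∀ k, ∃ m : ℤ, N * q k = m := by
  classical
  refine ⟨∏ k, (q k).den, Finset.prod_ne_zero_iff.mpr fun k _ => (q k).den_nz, fun k => ?_⟩
  refine ⟨(∏ l ∈ Finset.univ.erase k, (q l).den : ℕ) * (q k).num, ?_⟩
  rw [← Finset.mul_prod_erase Finset.univ _ (Finset.mem_univ k)]
  push_cast
  rw [mul_comm ((q k).den : ℚ), mul_assoc, Rat.den_mul_eq_num]

theorem eratForm_admissible {n r : ℕ} {M : Matrix (Fin (n + r)) (Fin (n + 1)) ℚ}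
    {S : Finset (Fin n)} (h : IsPartlyEliminated M S) {i : Fin r} {j : Fin n} (hj : j ∉ S)
    (hp : M (lamIdx n i) j.castSucc ≠ 0) (χ : AddChar (Fin (n + r) → ℚ) ℂ) :
    (eratForm M S χ).Admissible i j where
  coef_ne := by
    simp only [eratForm, if_neg hj]
    exact AddChar.apply_ne_zero χ _
  lam_ne := hp
  y_self := h.diag j hj
  y_other s hs := by
    by_cases hS : s ∈ S
    · exact Or.inl (if_pos hS)
    · exact Or.inr (h.offDiag j hj s hS hs)
  y_num κ hκ := by
    have := Finsupp.support_single_subset hκ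
    rw [Finset.mem_singleton] at this
    rw [this]
    exact h.last j hj
  coprime s hs h0 := by
    rw [sub_eq_zero, eq_comm, EForm.substMono, mono_eq_one_iff] at h0
    by_cases hS : s ∈ S
    · have h1 := h0.2
      simp [eratForm, hS] at h1
    · have h1 := congrFun h0.1 (yIdx r s)
      simp only [EForm.substExp, eratForm, Pi.sub_apply, Pi.smul_apply, Pi.zero_apply,
        h.diag s hS, h.offDiag s hS j hj (Ne.symm hs), smul_zero, sub_zero] at h1
      exact one_ne_zero h1

/-- The quotient of the two branches `c^q`, principal, and `χ(q e)` of the powers of `c = χ(e)`,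
as a character of the exponent vectors through their `y_j`-coordinate. -/
noncomputable def branchChar {n r : ℕ} (χ : AddChar (Fin (n + r) → ℚ) ℂ) (e : Fin (n + r) → ℚ)
    (j : Fin n) : AddChar (Fin (n + r) → ℚ) ℂ where
  toFun κ := χ e ^ ((κ (yIdx r j) : ℚ) : ℂ) * χ (-κ (yIdx r j) • e)
  map_zero_eq_one' := by simp
  map_add_eq_mul' κ μ := by
    rw [Pi.add_apply, Rat.cast_add, Complex.cpow_add _ _ (AddChar.apply_ne_zero χ e), neg_add,
      add_smul, AddChar.map_add_eq_mul]
    ring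

theorem branchChar_apply {n r : ℕ} (χ : AddChar (Fin (n + r) → ℚ) ℂ) (e : Fin (n + r) → ℚ)
    (j : Fin n) (κ : Fin (n + r) → ℚ) :
    branchChar χ e j κ = χ e ^ ((κ (yIdx r j) : ℚ) : ℂ) * χ (-κ (yIdx r j) • e) := rfl

theorem branchChar_eq_one {n r : ℕ} (χ : AddChar (Fin (n + r) → ℚ) ℂ) (e : Fin (n + r) → ℚ)
    (j : Fin n) {κ : Fin (n + r) → ℚ} (hκ : κ ∈ integralAt (yIdx r j)) :
    branchChar χ e j κ = 1 := by
  obtain ⟨m, hm⟩ := hκ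
  have h1 : -((m : ℤ) : ℚ) • e = (-m : ℤ) • e := by
    rw [← Int.cast_neg, Int.cast_smul_eq_zsmul]
  rw [branchChar_apply, hm, h1, AddChar.map_zsmul_eq_zpow, Rat.cast_intCast, Complex.cpow_intCast,
    zpow_neg, mul_inv_cancel₀ (zpow_ne_zero _ (AddChar.apply_ne_zero χ e))]

/-- The principal branch in the substitution and the branch given by `χ` differ by `branchChar`. -/
theorem mul_cpow_eq_branchChar {n r : ℕ} (χ : AddChar (Fin (n + r) → ℚ) ℂ)
    {e κ : Fin (n + r) → ℚ} {j : Fin n} (he : e (yIdx r j) = 1) (hκ : κ (yIdx r j) = 0) (q : ℚ) :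
    χ κ * χ e ^ ((-q : ℚ) : ℂ) = (χ * branchChar χ e j) (κ - q • e) := by
  have h1 : (κ - q • e) (yIdx r j) = -q := by
    rw [Pi.sub_apply, Pi.smul_apply, he, hκ, smul_eq_mul]; ring
  rw [AddChar.mul_apply, branchChar_apply, h1, neg_neg, mul_left_comm, ← AddChar.map_add_eq_mul,
    sub_add_cancel, mul_comm]

/-- One constant term of a twist of `[M]` is the corresponding twist of the pivoted function. -/
theorem eratForm_ct {n r : ℕ} {M : Matrix (Fin (n + r)) (Fin (n + 1)) ℚ}
    {S : Finset (Fin n)} (h : IsPartlyEliminated M S) (i : Fin r) {j : Fin n} (hj : j ∉ S)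
    (χ : AddChar (Fin (n + r) → ℚ) ℂ) :
    (eratForm M S χ).ct i j =
      ((SignType.sign (M (lamIdx n i) j.castSucc) : ℤ) : FracSeries n r) *
        expProj (integralAt (yIdx r j)) (twist χ (eratRest (pivot M i j) (insert j S))) := by
  have hexp : ∀ s : Fin (n + 1), s ≠ j.castSucc →
      (eratForm M S χ).substExp i j (fun p => M p s) = fun p => pivot M i j p s := by
    intro s hs
    ext p
    rw [pivot_apply_of_ne _ _ _ _ hs]
    rfl
  have hcoef : ∀ s : Fin (n + 1), M (yIdx r j) s = 0 → s ≠ j.castSucc →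
      χ (fun p => M p s) * (eratForm M S χ).substCoef i j (fun p => M p s) =
        (χ * branchChar χ (fun p => M p j.castSucc) j) fun p => pivot M i j p s := by
    intro s h0 hs
    rw [← hexp s hs, EForm.substCoef, EForm.substExp]
    have : (eratForm M S χ).coef j = χ fun p => M p j.castSucc := if_neg hj
    rw [this, mul_cpow_eq_branchChar χ (h.diag j hj) h0]
    rfl
  rw [← expProj_twist_mul χ (branchChar χ (fun p => M p j.castSucc) j)
    (fun κ hκ => branchChar_eq_one _ _ _ hκ), ← eratForm_val, EForm.ct, Zop_eq_expProj]
  congr 2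
  rw [EForm.val]
  congr 1
  · rw [FracLaurent.toSeries]
    simp only [eratForm]
    rw [Finsupp.sum_single_index (mono_coef_zero _), Finsupp.sum_single_index
      (by rw [EForm.substMono, zero_mul, mono_coef_zero])]
    rw [← hcoef _ (h.last j hj) (Fin.castSucc_lt_last j).ne',
      ← hexp _ (Fin.castSucc_lt_last j).ne']
    rfl
  · rw [← Finset.mul_prod_erase Finset.univ _ (Finset.mem_univ j)]
    have hjj : (eratForm (pivot M i j) (insert j S)
        (χ * branchChar χ (fun p => M p j.castSucc) j)).coef j = 0 :=
      if_pos (Finset.mem_insert_self j S)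
    rw [hjj, mono_coef_zero, sub_zero, one_mul]
    refine Finset.prod_congr rfl fun s hs => ?_
    have hsj := Finset.ne_of_mem_erase hs
    have hsj' : s.castSucc ≠ j.castSucc := fun h' => hsj (Fin.castSucc_injective n h')
    rw [EForm.substMono]
    by_cases hS : s ∈ S
    · have h1 : (eratForm M S χ).coef s = 0 := if_pos hS
      have h2 : (eratForm (pivot M i j) (insert j S)
        (χ * branchChar χ (fun p => M p j.castSucc) j)).coef s = 0 :=
        if_pos (Finset.mem_insert_of_mem hS)
      rw [h1, h2, zero_mul, mono_coef_zero, mono_coef_zero]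
    · have h1 : (eratForm M S χ).coef s = χ fun p => M p s.castSucc := if_neg hS
      have h2 : (eratForm (pivot M i j) (insert j S)
        (χ * branchChar χ (fun p => M p j.castSucc) j)).coef s =
          (χ * branchChar χ (fun p => M p j.castSucc) j) fun p => pivot M i j p s.castSucc :=
        if_neg (fun h' => (Finset.mem_insert.mp h').elim hsj hS)
      have h3 : (eratForm M S χ).expo s = fun p => M p s.castSucc := rfl
      rw [h1, h2, h3, hexp _ hsj', hcoef _ (h.offDiag j hj s hS hsj) hsj']
      rfl

theorem intCast_mul_eq_smul {n r : ℕ} (z : ℤ) (F : FracSeries n r) :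
    (z : FracSeries n r) * F = (z : ℂ) • F := by
  rw [← HahnSeries.C_mul_eq_smul, map_intCast]

/-- One step of the elimination: the constant term in `λ_i` with respect to the `j`-th factor
pivots the matrix at `(i, j)` and removes the `j`-th factor. -/
theorem isCT_eratRest {n r : ℕ} {M : Matrix (Fin (n + r)) (Fin (n + 1)) ℚ}
    {S : Finset (Fin n)} (h : IsPartlyEliminated M S) {i : Fin r} {j : Fin n} (hj : j ∉ S)
    (hp : M (lamIdx n i) j.castSucc ≠ 0) :
    IsCT i j (expProj (yFractional n r 1) (eratRest M S))
      (((SignType.sign (M (lamIdx n i) j.castSucc) : ℤ) : FracSeries n r) *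
        expProj (yFractional n r 1) (eratRest (pivot M i j) (insert j S))) := by
  -- The same roots of unity serve before and after the pivoting: `N` is a common denominator of
  -- both matrices.
  obtain ⟨N, hN, hq⟩ := exists_common_denominator
    (fun k : (Fin (n + r) × Fin (n + 1)) ⊕ (Fin (n + r) × Fin (n + 1)) =>
      Sum.elim (fun k => M k.1 k.2) (fun k => pivot M i j k.1 k.2) k)
  have h1 : expProj (yFractional n r N) (eratRest M S) = eratRest M S :=
    expProj_eratRest (fun s _ p => hq (Sum.inl (_, _))) (fun p => hq (Sum.inl (_, _)))
  have h2 : expProj (yFractional n r N) (eratRest (pivot M i j) (insert j S)) =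
      eratRest (pivot M i j) (insert j S) :=
    expProj_eratRest (fun s _ p => hq (Sum.inr (_, _))) (fun p => hq (Sum.inr (_, _)))
  refine ⟨(Finset.univ : Finset (Fin n → Fin N)).toList.map fun k =>
    (eratForm M S (rootChar r fun p => (k p : ℕ))).scale ((N : ℂ) ^ n)⁻¹, ?_, ?_, ?_⟩
  · intro E hE
    obtain ⟨k, -, rfl⟩ := List.mem_map.mp hE
    exact (eratForm_admissible h hj hp _).scale _
  · rw [expProj_eq_average hN h1, List.map_map, Finset.sum_map_toList, Finset.smul_sum]
    refine Finset.sum_congr rfl fun k _ => ?_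
    rw [Function.comp_apply, EForm.scale_val, eratForm_val]
  · rw [List.map_map, Finset.sum_map_toList,
      ← expProj_expProj_of_le (yFractional_one_le n r j), expProj_eq_average hN h2, map_smul,
      map_sum, Finset.smul_sum, Finset.mul_sum]
    refine Finset.sum_congr rfl fun k _ => ?_
    rw [Function.comp_apply, EForm.scale_ct _ _ _ _ (eratForm_admissible h hj hp _).coef_ne,
      eratForm_ct h i hj, intCast_mul_eq_smul, intCast_mul_eq_smul, smul_comm]

/-- The product of the signs of the pivot items met along a list of pivot positions. -/
def pivotSign {n r : ℕ} : Matrix (Fin (n + r)) (Fin (n + 1)) ℚ → List (Fin r × Fin n) → ℤ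
  | _, [] => 1
  | M, p :: l => (SignType.sign (M (lamIdx n p.1) p.2.castSucc) : ℤ) *
      pivotSign (pivot M p.1 p.2) l

theorem IsPartlyEliminated.pivotList {n r : ℕ} (l : List (Fin r × Fin n))
    {M : Matrix (Fin (n + r)) (Fin (n + 1)) ℚ} {S : Finset (Fin n)} (h : IsPartlyEliminated M S)
    (hl : (l.map Prod.snd).Nodup) (hS : ∀ p ∈ l, p.2 ∉ S) :
    IsPartlyEliminated (pivots M l) (S ∪ (l.map Prod.snd).toFinset) := by
  induction l generalizing M S with
  | nil => simpa [pivots] using h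
  | cons p l ih =>
    rw [List.map_cons, List.nodup_cons] at hl
    have h1 := ih (h.pivot p.1 (hS p List.mem_cons_self)) hl.2 (fun q hq hmem => by
      rcases Finset.mem_insert.mp hmem with h' | h'
      · exact hl.1 (h' ▸ List.mem_map_of_mem hq)
      · exact hS q (List.mem_cons_of_mem p hq) h')
    have h2 : insert p.2 S ∪ (l.map Prod.snd).toFinset =
        S ∪ ((p :: l).map Prod.snd).toFinset := by
      rw [List.map_cons, List.toFinset_cons, Finset.insert_union, Finset.union_insert]
    rw [h2] at h1
    exact h1

/-- The iterated constant term of `[M]` is given by the iterated pivoting of `M`. -/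
theorem isIterCT_eratRest {n r : ℕ} (l : List (Fin r × Fin n))
    {M : Matrix (Fin (n + r)) (Fin (n + 1)) ℚ} {S : Finset (Fin n)} (h : IsPartlyEliminated M S)
    (hl : (l.map Prod.snd).Nodup) (hS : ∀ p ∈ l, p.2 ∉ S) (hp : PivotsNeZero M l) :
    IsIterCT l (expProj (yFractional n r 1) (eratRest M S))
      ((pivotSign M l : FracSeries n r) *
        expProj (yFractional n r 1)
          (eratRest (pivots M l) (S ∪ (l.map Prod.snd).toFinset))) := by
  induction l generalizing M S with
  | nil => simp [IsIterCT, pivotSign, pivots]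
  | cons p l ih =>
    rw [List.map_cons, List.nodup_cons] at hl
    have hj := hS p List.mem_cons_self
    have h1 := ih (h.pivot p.1 hj) hl.2 (fun q hq hmem => by
      rcases Finset.mem_insert.mp hmem with h' | h'
      · exact hl.1 (h' ▸ List.mem_map_of_mem hq)
      · exact hS q (List.mem_cons_of_mem p hq) h') hp.2
    have h2 : insert p.2 S ∪ (l.map Prod.snd).toFinset =
        S ∪ ((p :: l).map Prod.snd).toFinset := by
      rw [List.map_cons, List.toFinset_cons, Finset.insert_union, Finset.union_insert]
    rw [h2] at h1
    refine ⟨_, isCT_eratRest h hj hp.1, ?_⟩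
    have h3 := h1.smul ((SignType.sign (M (lamIdx n p.1) p.2.castSucc) : ℤ) : ℂ)
    rw [← intCast_mul_eq_smul, ← intCast_mul_eq_smul, ← mul_assoc, ← Int.cast_mul] at h3
    exact h3

/-! ### Gaussian column elimination -/

theorem systemMatrix_y_castSucc {n r : ℕ} (A : Matrix (Fin r) (Fin n) ℤ) (b : Fin r → ℤ)
    (p s : Fin n) : systemMatrix A b (yIdx r p) s.castSucc = if p = s then 1 else 0 := by
  have h1 : finSumFinEquiv.symm (yIdx r p) = Sum.inl p := by simp
  have h2 : (finSumFinEquiv.symm s.castSucc : Fin n ⊕ Fin 1) = Sum.inl s :=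
    finSumFinEquiv_symm_apply_castAdd s
  rw [systemMatrix, Matrix.reindex_apply, Matrix.submatrix_apply, h1, h2, Matrix.fromBlocks_apply₁₁,
    Matrix.one_apply]

theorem systemMatrix_y_last {n r : ℕ} (A : Matrix (Fin r) (Fin n) ℤ) (b : Fin r → ℤ)
    (p : Fin n) : systemMatrix A b (yIdx r p) (Fin.last n) = 0 := by
  have h1 : finSumFinEquiv.symm (yIdx r p) = Sum.inl p := by simp
  have h2 : (finSumFinEquiv.symm (Fin.last n) : Fin n ⊕ Fin 1) = Sum.inr 0 :=
    finSumFinEquiv_symm_apply_natAdd (0 : Fin 1)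
  rw [systemMatrix, Matrix.reindex_apply, Matrix.submatrix_apply, h1, h2, Matrix.fromBlocks_apply₁₂,
    Matrix.zero_apply]

theorem systemMatrix_lam_castSucc {n r : ℕ} (A : Matrix (Fin r) (Fin n) ℤ) (b : Fin r → ℤ)
    (i : Fin r) (s : Fin n) : systemMatrix A b (lamIdx n i) s.castSucc = A i s := by
  have h1 : finSumFinEquiv.symm (lamIdx n i) = Sum.inr i := by simp
  have h2 : (finSumFinEquiv.symm s.castSucc : Fin n ⊕ Fin 1) = Sum.inl s :=
    finSumFinEquiv_symm_apply_castAdd s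
  rw [systemMatrix, Matrix.reindex_apply, Matrix.submatrix_apply, h1, h2, Matrix.fromBlocks_apply₂₁,
    Matrix.map_apply]

theorem systemMatrix_lam_last {n r : ℕ} (A : Matrix (Fin r) (Fin n) ℤ) (b : Fin r → ℤ)
    (i : Fin r) : systemMatrix A b (lamIdx n i) (Fin.last n) = -(b i : ℚ) := by
  have h1 : finSumFinEquiv.symm (lamIdx n i) = Sum.inr i := by simp
  have h2 : (finSumFinEquiv.symm (Fin.last n) : Fin n ⊕ Fin 1) = Sum.inr 0 :=
    finSumFinEquiv_symm_apply_natAdd (0 : Fin 1)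
  rw [systemMatrix, Matrix.reindex_apply, Matrix.submatrix_apply, h1, h2, Matrix.fromBlocks_apply₂₂,
    Matrix.of_apply]

theorem isPartlyEliminated_systemMatrix {n r : ℕ} (A : Matrix (Fin r) (Fin n) ℤ) (b : Fin r → ℤ) :
    IsPartlyEliminated (systemMatrix A b) ∅ where
  diag j _ := by rw [systemMatrix_y_castSucc, if_pos rfl]
  offDiag j _ s _ hs := by rw [systemMatrix_y_castSucc, if_neg (Ne.symm hs)]
  last j _ := systemMatrix_y_last A b j

theorem pivot_row_eq_self {n r : ℕ} {M : Matrix (Fin (n + r)) (Fin (n + 1)) ℚ} (i : Fin r)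
    {j : Fin n} {q : Fin (n + r)} (h : M q j.castSucc = 0) (t : Fin (n + 1)) :
    pivot M i j q t = M q t := by
  by_cases ht : t = j.castSucc
  · rw [ht, pivot_apply_self]
  · rw [pivot_apply_of_ne _ _ _ _ ht, h, mul_zero, sub_zero]

/-- Later pivots do not change a row that has become zero in their columns. -/
theorem pivots_row_eq_self {n r : ℕ} (l : List (Fin r × Fin n))
    {M : Matrix (Fin (n + r)) (Fin (n + 1)) ℚ} {q : Fin (n + r)}
    (h : ∀ p ∈ l, M q p.2.castSucc = 0) (t : Fin (n + 1)) : pivots M l q t = M q t := by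
  induction l generalizing M with
  | nil => rfl
  | cons p l ih =>
    have h0 := pivot_row_eq_self p.1 (h p List.mem_cons_self)
    rw [← h0 t]
    exact ih (M := pivot M p.1 p.2) fun p' hp' => by
      rw [h0]; exact h p' (List.mem_cons_of_mem p hp')

theorem pivot_pivotRow {n r : ℕ} {M : Matrix (Fin (n + r)) (Fin (n + 1)) ℚ} {i : Fin r}
    {j : Fin n} (h : M (lamIdx n i) j.castSucc ≠ 0) {t : Fin (n + 1)} (ht : t ≠ j.castSucc) :
    pivot M i j (lamIdx n i) t = 0 := by
  rw [pivot_apply_of_ne _ _ _ _ ht, div_mul_cancel₀ _ h, sub_self]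

/-- After the elimination, each pivot row vanishes outside its pivot column. -/
theorem pivots_pivotRow {n r : ℕ} (l : List (Fin r × Fin n))
    {M : Matrix (Fin (n + r)) (Fin (n + 1)) ℚ} (hp : PivotsNeZero M l)
    (hl : (l.map Prod.snd).Nodup) {p : Fin r × Fin n} (hpl : p ∈ l) {t : Fin (n + 1)}
    (ht : t ≠ p.2.castSucc) : pivots M l (lamIdx n p.1) t = 0 := by
  induction l generalizing M with
  | nil => exact absurd hpl List.not_mem_nil
  | cons p' l ih =>
    rw [List.map_cons, List.nodup_cons] at hl
    rcases List.mem_cons.mp hpl with rfl | hpl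
    · refine (pivots_row_eq_self l (M := pivot M p.1 p.2) (fun q hq => ?_) t).trans
        (pivot_pivotRow hp.1 ht)
      refine pivot_pivotRow hp.1 fun h => hl.1 ?_
      rw [← Fin.castSucc_injective n h]
      exact List.mem_map_of_mem hq
    · exact ih hp.2 hl.2 hpl

/-- Each column `x` of the eliminated matrix, with `λ`-part `z`, satisfies `z = A x`, and
`z = A x - b` for the last column. -/
def IsSystemMatrix {n r : ℕ} (A : Matrix (Fin r) (Fin n) ℤ) (b : Fin r → ℤ)
    (M : Matrix (Fin (n + r)) (Fin (n + 1)) ℚ) : Prop :=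
  ∀ i t, M (lamIdx n i) t =
    ∑ p, (A i p : ℚ) * M (yIdx r p) t - if t = Fin.last n then (b i : ℚ) else 0

theorem isSystemMatrix_systemMatrix {n r : ℕ} (A : Matrix (Fin r) (Fin n) ℤ) (b : Fin r → ℤ) :
    IsSystemMatrix A b (systemMatrix A b) := by
  intro i t
  refine Fin.lastCases ?_ (fun s => ?_) t
  · simp [systemMatrix_lam_last, systemMatrix_y_last]
  · simp [systemMatrix_lam_castSucc, systemMatrix_y_castSucc, (Fin.castSucc_lt_last s).ne]

theorem IsSystemMatrix.pivot {n r : ℕ} {A : Matrix (Fin r) (Fin n) ℤ} {b : Fin r → ℤ}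
    {M : Matrix (Fin (n + r)) (Fin (n + 1)) ℚ} (h : IsSystemMatrix A b M) (i : Fin r)
    (j : Fin n) : IsSystemMatrix A b (pivot M i j) := by
  intro i' t
  by_cases ht : t = j.castSucc
  · subst ht
    simp only [pivot_apply_self]
    exact h i' _
  · simp only [pivot_apply_of_ne _ _ _ _ ht]
    rw [h i' t, h i' j.castSucc, if_neg (Fin.castSucc_lt_last j).ne]
    simp only [mul_sub, Finset.sum_sub_distrib, Finset.mul_sum, sub_zero]
    rw [sub_right_comm]
    congr 2
    exact Finset.sum_congr rfl fun p _ => by ring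

theorem IsSystemMatrix.pivotList {n r : ℕ} {A : Matrix (Fin r) (Fin n) ℤ} {b : Fin r → ℤ}
    (l : List (Fin r × Fin n)) {M : Matrix (Fin (n + r)) (Fin (n + 1)) ℚ}
    (h : IsSystemMatrix A b M) : IsSystemMatrix A b (pivots M l) := by
  induction l generalizing M with
  | nil => exact h
  | cons p l ih => exact ih (h.pivot p.1 p.2)

/-- The sign of the minor of the pivot rows and columns is the product of the signs of the pivot
items, and the minor is nonzero. -/
theorem sign_det_eq_pivotSign {n r m : ℕ} (i : Fin m → Fin r) (j : Fin m → Fin n)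
    (hj : Function.Injective j) (M : Matrix (Fin (n + r)) (Fin (n + 1)) ℚ)
    (hp : PivotsNeZero M (List.ofFn fun k => (i k, j k))) :
    (SignType.sign (Matrix.of fun s t => M (lamIdx n (i s)) (j t).castSucc).det : ℤ) =
      pivotSign M (List.ofFn fun k => (i k, j k)) ∧
    (Matrix.of fun s t => M (lamIdx n (i s)) (j t).castSucc).det ≠ 0 := by
  induction m generalizing M with
  | zero => simp [pivotSign]
  | succ m ih =>
    rw [List.ofFn_succ] at hp ⊢
    have hne : ∀ t : Fin m, (j t.succ).castSucc ≠ (j 0).castSucc := fun t h =>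
      Fin.succ_ne_zero t (hj (Fin.castSucc_injective n h))
    have ih' := ih (fun k => i k.succ) (fun k => j k.succ)
      (fun a c hac => Fin.succ_injective m (hj hac)) (pivot M (i 0) (j 0)) hp.2
    -- Column operations do not change the minor.
    have h1 : (Matrix.of fun s t => M (lamIdx n (i s)) (j t).castSucc).det =
        (Matrix.of fun s t => pivot M (i 0) (j 0) (lamIdx n (i s)) (j t).castSucc).det := by
      rw [← Matrix.det_transpose, ← Matrix.det_transpose (Matrix.of fun s t => pivot M _ _ _ _)]
      refine (Matrix.det_eq_of_forall_row_eq_smul_add_const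
        (fun t => if t = 0 then 0 else
          -(M (lamIdx n (i 0)) (j t).castSucc / M (lamIdx n (i 0)) (j 0).castSucc)) 0
        (if_pos rfl) fun t s => ?_).symm
      simp only [Matrix.transpose_apply, Matrix.of_apply]
      refine Fin.cases ?_ (fun t => ?_) t
      · rw [pivot_apply_self, if_pos rfl, zero_mul, add_zero]
      · rw [pivot_apply_of_ne _ _ _ _ (hne t), if_neg (Fin.succ_ne_zero t)]
        ring
    -- The first row of the pivoted minor vanishes off the diagonal.
    have h2 : (Matrix.of fun s t => M (lamIdx n (i s)) (j t).castSucc).det =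
        M (lamIdx n (i 0)) (j 0).castSucc *
        (Matrix.of fun (s t : Fin m) =>
          pivot M (i 0) (j 0) (lamIdx n (i s.succ)) (j t.succ).castSucc).det := by
      rw [h1, Matrix.det_succ_row_zero, Fin.sum_univ_succ, Finset.sum_eq_zero, add_zero]
      · simp only [Matrix.of_apply, pivot_apply_self, Fin.val_zero, pow_zero, one_mul]
        rfl
      · intro t _
        rw [Matrix.of_apply, pivot_pivotRow hp.1 (hne t), mul_zero, zero_mul]
    rw [h2]
    refine ⟨?_, mul_ne_zero hp.1 ih'.2⟩
    rw [sign_mul, pivotSign, ← ih'.1]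
    push_cast
    rfl

/-! ### Formal series and their rational functions -/

/-- The action of Laurent polynomials on formal series with exponents in `ℤ^n`, as functions
`ℤ^n → ℂ`, by convolution. -/
noncomputable def laurentAction {n : ℕ} :
    AddMonoidAlgebra ℂ (Fin n → ℤ) →ₐ[ℂ] Module.End ℂ ((Fin n → ℤ) → ℂ) :=
  AddMonoidAlgebra.lift ℂ (Module.End ℂ ((Fin n → ℤ) → ℂ)) (Fin n → ℤ)
    { toFun := fun κ => LinearMap.funLeft ℂ ℂ fun β => β - κ.toAdd
      map_one' := by
        ext f β
        simp [LinearMap.funLeft_apply]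
      map_mul' := fun κ μ => by
        refine LinearMap.ext fun f => funext fun β => ?_
        simp [LinearMap.funLeft_apply, sub_sub] }

theorem laurentAction_apply {n : ℕ} (Q : AddMonoidAlgebra ℂ (Fin n → ℤ)) (f : (Fin n → ℤ) → ℂ)
    (β : Fin n → ℤ) : laurentAction Q f β = Q.coeff.sum fun κ a => a * f (β - κ) := by
  rw [laurentAction, AddMonoidAlgebra.lift_apply, LinearMap.finsupp_sum_apply, Finsupp.sum,
    Finset.sum_apply, Finsupp.sum]
  rfl

theorem laurentAction_single {n : ℕ} (κ : Fin n → ℤ) (a : ℂ) (f : (Fin n → ℤ) → ℂ)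
    (β : Fin n → ℤ) : laurentAction (AddMonoidAlgebra.single κ a) f β = a * f (β - κ) := by
  rw [laurentAction_apply]
  exact Finsupp.sum_single_index (by simp)

theorem laurentAction_delta {n : ℕ} (P : AddMonoidAlgebra ℂ (Fin n → ℤ)) :
    laurentAction P (Pi.single 0 1) = P.coeff := by
  ext β
  rw [laurentAction_apply, Finsupp.sum, Finset.sum_eq_single β]
  · simp
  · intro κ _ hκ
    rw [Pi.single_eq_of_ne (sub_ne_zero.mpr (Ne.symm hκ)), mul_zero]
  · intro h
    rw [Finsupp.notMem_support_iff.mp h, zero_mul]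

/-- A rational function whose expansion is a given formal series is unique. -/
theorem mul_eq_mul_of_laurentAction {n : ℕ} {P Q P' Q' : AddMonoidAlgebra ℂ (Fin n → ℤ)}
    {f : (Fin n → ℤ) → ℂ} (h : laurentAction Q f = P.coeff) (h' : laurentAction Q' f = P'.coeff) :
    P * Q' = P' * Q := by
  have h1 : laurentAction (Q' * P) (Pi.single 0 1) = laurentAction (Q * P') (Pi.single 0 1) := by
    rw [map_mul, map_mul, Module.End.mul_apply, Module.End.mul_apply, laurentAction_delta,
      laurentAction_delta, ← h, ← h', ← Module.End.mul_apply, ← Module.End.mul_apply, ← map_mul,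
      ← map_mul, mul_comm]
  rw [laurentAction_delta, laurentAction_delta] at h1
  rw [mul_comm P, mul_comm P']
  exact AddMonoidAlgebra.coeffEquiv.injective (DFunLike.coe_injective h1)

/-- The exponent vector in `y, Λ` of an integral exponent vector in `y`. -/
def yExp {n : ℕ} (r : ℕ) : (Fin n → ℤ) →+ (Fin (n + r) → ℚ) where
  toFun α := Fin.append (fun p => (α p : ℚ)) 0
  map_zero' := by
    ext p
    refine Fin.addCases (fun p => ?_) (fun p => ?_) p <;> simp
  map_add' α β := by
    ext p
    refine Fin.addCases (fun p => ?_) (fun p => ?_) p <;> simp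

theorem yExp_yIdx {n r : ℕ} (α : Fin n → ℤ) (p : Fin n) : yExp r α (yIdx r p) = α p :=
  Fin.append_left (fun p => (α p : ℚ)) (0 : Fin r → ℚ) p

theorem yExp_lamIdx {n r : ℕ} (α : Fin n → ℤ) (i : Fin r) : yExp r α (lamIdx n i) = 0 :=
  Fin.append_right (fun p => (α p : ℚ)) (0 : Fin r → ℚ) i

theorem yExp_injective {n r : ℕ} : Function.Injective (yExp r : (Fin n → ℤ) →+ _) := by
  intro α β h
  ext p
  have := congrFun h (yIdx r p)
  rw [yExp_yIdx, yExp_yIdx] at this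
  exact_mod_cast this

/-- `laurentY` as an algebra homomorphism. -/
noncomputable def laurentYHom {n : ℕ} (r : ℕ) :
    AddMonoidAlgebra ℂ (Fin n → ℤ) →ₐ[ℂ] FracSeries n r :=
  laurentSeries.comp (AddMonoidAlgebra.mapDomainAlgHom ℂ ℂ (yExp r))

theorem laurentYHom_single {n r : ℕ} (α : Fin n → ℤ) (a : ℂ) :
    laurentYHom r (AddMonoidAlgebra.single α a) = mono (yExp r α) a := by
  rw [laurentYHom, AlgHom.comp_apply, AddMonoidAlgebra.mapDomainAlgHom_apply,
    AddMonoidAlgebra.mapDomain_single, laurentSeries_single]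

theorem laurentYHom_injective {n r : ℕ} :
    Function.Injective (laurentYHom r : AddMonoidAlgebra ℂ (Fin n → ℤ) →ₐ[ℂ] FracSeries n r) := by
  intro P Q h
  exact AddMonoidAlgebra.mapDomain_injective yExp_injective (laurentSeries_injective h)

theorem laurentY_eq {n r : ℕ} (P : AddMonoidAlgebra ℂ (Fin n → ℤ)) :
    laurentY r P.coeff = laurentYHom r P := by
  induction P using AddMonoidAlgebra.induction_linear with
  | zero => simp [laurentY]
  | add P Q hP hQ =>
    rw [map_add, ← hP, ← hQ]
    exact Finsupp.sum_add_index' (fun κ => mono_coef_zero _) (fun κ a b => mono_add _ a b)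
  | single α a =>
    rw [laurentYHom_single]
    exact Finsupp.sum_single_index (mono_coef_zero _)

/-- The rational function of a lattice point generating function is unique. -/
theorem IsLatticeGF.unique {n r : ℕ} {S : Set (Fin n → ℝ)} {R R' : FracSeries n r}
    (h : IsLatticeGF S R) (h' : IsLatticeGF S R') : R = R' := by
  obtain ⟨P, Q, hQ, hPQ, rfl⟩ := h
  obtain ⟨P', Q', hQ', hPQ', rfl⟩ := h'
  have key := mul_eq_mul_of_laurentAction (P := .ofCoeff P) (Q := .ofCoeff Q) (P' := .ofCoeff P')
    (Q' := .ofCoeff Q') (f := latticeCoeff S)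
    (funext fun β => (laurentAction_apply _ _ β).trans (hPQ β))
    (funext fun β => (laurentAction_apply _ _ β).trans (hPQ' β))
  have hne : ∀ {Q : (Fin n → ℤ) →₀ ℂ}, Q ≠ 0 → laurentY r Q ≠ 0 := by
    intro Q hQ h0
    have h1 : laurentYHom r (.ofCoeff Q) = 0 := (laurentY_eq _).symm.trans h0
    exact hQ (congrArg AddMonoidAlgebra.coeff ((map_eq_zero_iff _ laurentYHom_injective).mp h1))
  rw [div_eq_div_iff (hne hQ) (hne hQ')]
  have h1 := congrArg (laurentYHom r) key
  rw [map_mul, map_mul, ← laurentY_eq, ← laurentY_eq, ← laurentY_eq, ← laurentY_eq] at h1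
  exact h1

/-! ### Lattice points of the cone -/

/-- The first `n` rows of a matrix of columns `(y, Λ)^γ`. -/
def yRows {n r : ℕ} (M : Matrix (Fin (n + r)) (Fin (n + 1)) ℚ) : Matrix (Fin n) (Fin (n + 1)) ℚ :=
  Matrix.of fun p s => M (yIdx r p) s

/-- The block form of the eliminated matrix (first `n` rows): the rows and columns outside `J` form
an identity block, and the last column vanishes in these rows. -/
structure HasIdentityBlock {n : ℕ} (N : Matrix (Fin n) (Fin (n + 1)) ℚ) (J : Finset (Fin n)) :
    Prop where
  diag : ∀ s ∉ J, N s s.castSucc = 1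
  offDiag : ∀ j ∉ J, ∀ s ∉ J, s ≠ j → N j s.castSucc = 0
  last : ∀ s ∉ J, N s (Fin.last n) = 0

theorem HasIdentityBlock.sum_eq {n : ℕ} {N : Matrix (Fin n) (Fin (n + 1)) ℚ} {J : Finset (Fin n)}
    (h : HasIdentityBlock N J) (k : Fin n → ℚ) {s : Fin n} (hs : s ∉ J) :
    N s (Fin.last n) + ∑ t ∈ Jᶜ, k t * N s t.castSucc = k s := by
  rw [h.last s hs, zero_add, Finset.sum_eq_single s, h.diag s hs, mul_one]
  · intro t ht hts
    rw [h.offDiag s hs t (Finset.mem_compl.mp ht) hts, mul_zero]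
  · intro hs'
    exact absurd (Finset.mem_compl.mpr hs) hs'

theorem HasIdentityBlock.linearIndependent {n : ℕ} {N : Matrix (Fin n) (Fin (n + 1)) ℚ}
    {J : Finset (Fin n)} (h : HasIdentityBlock N J) : LinearIndependent ℝ (coneGens N J) := by
  rw [Fintype.linearIndependent_iff]
  intro g hg s
  have h1 := congrFun hg s.1
  rw [Finset.sum_apply, Finset.sum_eq_single s] at h1
  · simpa [coneGens, h.diag s.1 s.2] using h1
  · intro t _ hts
    have : (t : Fin n) ≠ s := fun h' => hts (Subtype.ext h')
    simp [coneGens, h.offDiag s.1 s.2 t.1 t.2 this]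
  · simp

/-- The lattice points `v + ∑ k_s w_s` of the cone with `k_s < D` for `s ∈ S`; the coefficient `k_s`
is the `s`-th coordinate of the point. -/
def boxPoints {n : ℕ} (N : Matrix (Fin n) (Fin (n + 1)) ℚ) (J S : Finset (Fin n)) (D : ℕ) :
    Set (Fin n → ℤ) :=
  {β | (∀ s ∉ J, 0 ≤ β s) ∧ (∀ s ∈ S, β s < D) ∧
    ∀ p, (β p : ℚ) = N p (Fin.last n) + ∑ s ∈ Jᶜ, (β s : ℚ) * N p s.castSucc}

/-- The real coefficients of a lattice point of the cone are its coordinates outside `J`, so they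
are natural numbers. -/
theorem latticeCoeff_shiftedCone {n : ℕ} {N : Matrix (Fin n) (Fin (n + 1)) ℚ} {J : Finset (Fin n)}
    (h : HasIdentityBlock N J) (D : ℕ) :
    latticeCoeff (shiftedCone (coneGens N J) (coneVertex N)) =
      (boxPoints N J ∅ D).indicator fun _ => (1 : ℂ) := by
  classical
  have hsum : ∀ (k : Fin n → ℝ) (p : Fin n),
      (coneVertex N + ∑ s : {s : Fin n // s ∉ J}, k s • coneGens N J s) p =
        N p (Fin.last n) + ∑ s ∈ Jᶜ, k s * N p s.castSucc := by
    intro k p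
    rw [Pi.add_apply, Finset.sum_apply,
      Finset.sum_subtype Jᶜ (p := fun s => s ∉ J) (fun s => Finset.mem_compl)
        (fun s => k s * (N p s.castSucc : ℝ))]
    rfl
  funext β
  rw [latticeCoeff]
  have key : (fun p => (β p : ℝ)) ∈ shiftedCone (coneGens N J) (coneVertex N) ↔
      β ∈ boxPoints N J ∅ D := by
    constructor
    · rintro ⟨k, hk, hβ⟩
      let k' : Fin n → ℝ := fun s => if hs : s ∉ J then k ⟨s, hs⟩ else 0
      have hk' : ∀ s : {s : Fin n // s ∉ J}, k' s = k s := fun s => dif_pos s.2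
      have h1 : ∀ p, (β p : ℝ) = N p (Fin.last n) + ∑ s ∈ Jᶜ, k' s * N p s.castSucc := by
        intro p
        rw [← hsum]
        simp only [hk']
        exact congrFun hβ p
      have h2 : ∀ s ∉ J, k' s = β s := by
        intro s hs
        rw [h1 s, h.last s hs, Finset.sum_eq_single s, h.diag s hs]
        · simp
        · intro t ht hts
          rw [h.offDiag s hs t (Finset.mem_compl.mp ht) hts, Rat.cast_zero, mul_zero]
        · intro hs'
          exact absurd (Finset.mem_compl.mpr hs) hs'
      refine ⟨fun s hs => ?_, by simp, fun p => ?_⟩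
      · have h3 : (0 : ℝ) ≤ β s := by
          rw [← h2 s hs, hk' ⟨s, hs⟩]
          exact hk _
        exact_mod_cast h3
      · have h3 := h1 p
        rw [Finset.sum_congr rfl fun s hs => by rw [h2 s (Finset.mem_compl.mp hs)]] at h3
        exact_mod_cast h3
    · rintro ⟨h0, -, h1⟩
      refine ⟨fun s => β s, fun s => Int.cast_nonneg (h0 s s.2), ?_⟩
      funext p
      rw [hsum (fun s => (β s : ℝ)) p]
      exact_mod_cast h1 p
  by_cases hβ : β ∈ boxPoints N J ∅ D
  · rw [Set.indicator_of_mem hβ, Set.indicator_of_mem (key.mpr hβ)]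
  · rw [Set.indicator_of_notMem hβ, Set.indicator_of_notMem (fun h' => hβ (key.mp h'))]

/-- Multiplication by `1 - y^{D w_s}` removes the points with `k_s ≥ D`. -/
theorem laurentAction_one_sub_boxPoints {n : ℕ} {N : Matrix (Fin n) (Fin (n + 1)) ℚ}
    {J S : Finset (Fin n)} (h : HasIdentityBlock N J) {D : ℕ} {s : Fin n} (hsJ : s ∉ J)
    (hsS : s ∉ S) (hS : S ⊆ Jᶜ) {g : Fin n → ℤ} (hg : ∀ p, (g p : ℚ) = D * N p s.castSucc) :
    laurentAction (1 - AddMonoidAlgebra.single g 1)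
      ((boxPoints N J S D).indicator fun _ => (1 : ℂ)) =
      (boxPoints N J (insert s S) D).indicator fun _ => (1 : ℂ) := by
  classical
  funext β
  have hgs : g s = D := by
    have := hg s
    rw [h.diag s hsJ, mul_one] at this
    exact_mod_cast this
  have hgt : ∀ t ∉ J, t ≠ s → g t = 0 := by
    intro t ht hts
    have := hg t
    rw [h.offDiag t ht s hsJ (Ne.symm hts), mul_zero] at this
    exact_mod_cast this
  have hlin : ∀ p, ∑ t ∈ Jᶜ, ((β - g) t : ℚ) * N p t.castSucc =
      ∑ t ∈ Jᶜ, (β t : ℚ) * N p t.castSucc - g p := by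
    intro p
    have h1 : ∑ t ∈ Jᶜ, (g t : ℚ) * N p t.castSucc = g p := by
      rw [Finset.sum_eq_single s, hgs, hg, Int.cast_natCast]
      · intro t ht hts
        rw [hgt t (Finset.mem_compl.mp ht) hts, Int.cast_zero, zero_mul]
      · intro hs'
        exact absurd (Finset.mem_compl.mpr hsJ) hs'
    rw [← h1, ← Finset.sum_sub_distrib]
    exact Finset.sum_congr rfl fun t _ => by rw [Pi.sub_apply, Int.cast_sub, sub_mul]
  have hshift : β - g ∈ boxPoints N J S D ↔ β ∈ boxPoints N J S D ∧ (D : ℤ) ≤ β s := by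
    constructor
    · rintro ⟨h0, h1, h2⟩
      have hs0 := h0 s hsJ
      rw [Pi.sub_apply, hgs] at hs0
      refine ⟨⟨fun t ht => ?_, fun t ht => ?_, fun p => ?_⟩, by omega⟩
      · by_cases hts : t = s
        · subst hts; omega
        · have := h0 t ht
          rwa [Pi.sub_apply, hgt t ht hts, sub_zero] at this
      · have := h1 t ht
        rwa [Pi.sub_apply, hgt t (Finset.mem_compl.mp (hS ht)) (fun h' => hsS (h' ▸ ht)),
          sub_zero] at this
      · have := h2 p
        rw [hlin p, Pi.sub_apply, Int.cast_sub] at this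
        linarith
    · rintro ⟨⟨h0, h1, h2⟩, hD⟩
      refine ⟨fun t ht => ?_, fun t ht => ?_, fun p => ?_⟩
      · by_cases hts : t = s
        · subst hts
          rw [Pi.sub_apply, hgs]
          omega
        · rw [Pi.sub_apply, hgt t ht hts, sub_zero]
          exact h0 t ht
      · rw [Pi.sub_apply, hgt t (Finset.mem_compl.mp (hS ht)) (fun h' => hsS (h' ▸ ht)), sub_zero]
        exact h1 t ht
      · rw [hlin p, Pi.sub_apply, Int.cast_sub, h2 p]
        ring
  have hinsert : β ∈ boxPoints N J (insert s S) D ↔ β ∈ boxPoints N J S D ∧ β s < D := by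
    constructor
    · rintro ⟨h0, h1, h2⟩
      exact ⟨⟨h0, fun t ht => h1 t (Finset.mem_insert_of_mem ht), h2⟩,
        h1 s (Finset.mem_insert_self s S)⟩
    · rintro ⟨⟨h0, h1, h2⟩, hD⟩
      refine ⟨h0, fun t ht => ?_, h2⟩
      rcases Finset.mem_insert.mp ht with rfl | ht
      · exact hD
      · exact h1 t ht
  rw [map_sub, map_one, LinearMap.sub_apply, Module.End.one_apply, Pi.sub_apply,
    laurentAction_single, one_mul]
  simp only [Set.indicator_apply, hshift, hinsert]
  by_cases h1 : β ∈ boxPoints N J S D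
  · by_cases h2 : β s < D
    · simp [h1, h2]
    · simp [h1, h2, not_lt.mp h2]
  · simp [h1]

theorem laurentAction_prod_boxPoints {n : ℕ} {N : Matrix (Fin n) (Fin (n + 1)) ℚ}
    {J : Finset (Fin n)} (h : HasIdentityBlock N J) {D : ℕ} {g : Fin n → Fin n → ℤ}
    (hg : ∀ s ∉ J, ∀ p, (g s p : ℚ) = D * N p s.castSucc) {S : Finset (Fin n)} (hS : S ⊆ Jᶜ) :
    laurentAction (∏ s ∈ S, (1 - AddMonoidAlgebra.single (g s) 1))
      ((boxPoints N J ∅ D).indicator fun _ => (1 : ℂ)) =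
      (boxPoints N J S D).indicator fun _ => (1 : ℂ) := by
  classical
  induction S using Finset.induction_on with
  | empty => simp
  | insert s S hs ih =>
    have hsJ := Finset.mem_compl.mp (hS (Finset.mem_insert_self s S))
    have hS' : S ⊆ Jᶜ := fun t ht => hS (Finset.mem_insert_of_mem ht)
    rw [Finset.prod_insert hs, map_mul, Module.End.mul_apply, ih hS',
      laurentAction_one_sub_boxPoints h hsJ hs hS' (hg s hsJ)]

/-- The multi-indices `k` with `0 ≤ k_s < D` for `s ∉ J` and `k_s = 0` for `s ∈ J`. -/
def boxIndices {n : ℕ} (J : Finset (Fin n)) (D : ℕ) : Finset (Fin n → ℕ) :=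
  Fintype.piFinset fun s => if s ∈ J then {0} else Finset.range D

theorem mem_boxIndices {n : ℕ} {J : Finset (Fin n)} {D : ℕ} {k : Fin n → ℕ} :
    k ∈ boxIndices J D ↔ (∀ s ∈ J, k s = 0) ∧ ∀ s ∉ J, k s < D := by
  rw [boxIndices, Fintype.mem_piFinset]
  constructor
  · intro h
    refine ⟨fun s hs => ?_, fun s hs => ?_⟩
    · simpa [hs] using h s
    · simpa [hs] using h s
  · rintro ⟨h0, h1⟩ s
    by_cases hs : s ∈ J
    · simp [hs, h0 s hs]
    · simp [hs, h1 s hs]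

/-- The point `v + ∑ k_s w_s`. -/
def boxPoint {n : ℕ} (N : Matrix (Fin n) (Fin (n + 1)) ℚ) (k : Fin n → ℕ) : Fin n → ℚ :=
  fun p => N p (Fin.last n) + ∑ s, (k s : ℚ) * N p s.castSucc

theorem boxPoint_eq {n : ℕ} {N : Matrix (Fin n) (Fin (n + 1)) ℚ} {J : Finset (Fin n)}
    {k : Fin n → ℕ} (hk : ∀ s ∈ J, k s = 0) (p : Fin n) :
    boxPoint N k p = N p (Fin.last n) + ∑ s ∈ Jᶜ, (k s : ℚ) * N p s.castSucc := by
  rw [boxPoint, ← Finset.sum_subset (Finset.subset_univ Jᶜ)]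
  intro s _ hs
  rw [hk s (by simpa using hs), Nat.cast_zero, zero_mul]

open scoped Classical in
/-- The Laurent polynomial of the integral points `v + ∑ k_s w_s` with `0 ≤ k_s < D`. -/
noncomputable def boxPolynomial {n : ℕ} (N : Matrix (Fin n) (Fin (n + 1)) ℚ) (J : Finset (Fin n))
    (D : ℕ) : AddMonoidAlgebra ℂ (Fin n → ℤ) :=
  ∑ k ∈ boxIndices J D with ∀ p, ∃ m : ℤ, boxPoint N k p = m,
    AddMonoidAlgebra.single (fun p => ⌊boxPoint N k p⌋) 1

/-- A box point determines its multi-index, so all coefficients of the box polynomial are `0` or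
`1`. -/
theorem coeff_boxPolynomial {n : ℕ} {N : Matrix (Fin n) (Fin (n + 1)) ℚ} {J : Finset (Fin n)}
    (h : HasIdentityBlock N J) (D : ℕ) :
    ⇑(boxPolynomial N J D).coeff = (boxPoints N J Jᶜ D).indicator fun _ => (1 : ℂ) := by
  classical
  have hint : ∀ k : Fin n → ℕ, (∀ p, ∃ m : ℤ, boxPoint N k p = m) → ∀ p,
      ((⌊boxPoint N k p⌋ : ℤ) : ℚ) = boxPoint N k p := by
    intro k hk p
    obtain ⟨m, hm⟩ := hk p
    rw [hm, Int.floor_intCast]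
  have hcoord : ∀ k ∈ boxIndices J D, (∀ p, ∃ m : ℤ, boxPoint N k p = m) → ∀ s ∉ J,
      ⌊boxPoint N k s⌋ = k s := by
    intro k hk _ s hs
    rw [boxPoint_eq (mem_boxIndices.mp hk).1, h.sum_eq (fun t => (k t : ℚ)) hs, Int.floor_natCast]
  funext β
  have hcoeff : (boxPolynomial N J D).coeff β =
      ∑ k ∈ boxIndices J D with ∀ p, ∃ m : ℤ, boxPoint N k p = m,
        if (fun p => ⌊boxPoint N k p⌋) = β then (1 : ℂ) else 0 := by
    rw [boxPolynomial, AddMonoidAlgebra.coeff_sum, Finsupp.finsetSum_apply]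
    refine Finset.sum_congr rfl fun k _ => ?_
    rw [AddMonoidAlgebra.coeff_single, Finsupp.single_apply]
  rw [hcoeff]
  by_cases hβ : β ∈ boxPoints N J Jᶜ D
  · rw [Set.indicator_of_mem hβ]
    obtain ⟨h0, h1, h2⟩ := hβ
    obtain ⟨k₀, hk₀J, hk₀⟩ : ∃ k₀ : Fin n → ℕ, (∀ s ∈ J, k₀ s = 0) ∧ ∀ s ∉ J, (k₀ s : ℤ) = β s :=
      ⟨fun s => if s ∈ J then 0 else (β s).toNat, fun s hs => if_pos hs, fun s hs => by
        simp only [if_neg hs]; exact Int.toNat_of_nonneg (h0 s hs)⟩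
    have hpt : ∀ p, boxPoint N k₀ p = β p := by
      intro p
      rw [boxPoint_eq hk₀J, h2 p]
      congr 1
      refine Finset.sum_congr rfl fun s hs => ?_
      rw [← hk₀ s (Finset.mem_compl.mp hs), Int.cast_natCast]
    have hk₀mem : k₀ ∈ boxIndices J D := by
      refine mem_boxIndices.mpr ⟨hk₀J, fun s hs => ?_⟩
      have := h1 s (Finset.mem_compl.mpr hs)
      rw [← hk₀ s hs] at this
      exact_mod_cast this
    rw [Finset.sum_eq_single k₀]
    · refine if_pos (funext fun p => ?_)
      rw [hpt, Int.floor_intCast]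
    · intro k hk hne
      rw [Finset.mem_filter] at hk
      refine if_neg fun heq => hne (funext fun s => ?_)
      by_cases hs : s ∈ J
      · rw [(mem_boxIndices.mp hk.1).1 s hs, hk₀J s hs]
      · have h3 := hcoord k hk.1 hk.2 s hs
        have h4 : ⌊boxPoint N k s⌋ = β s := congrFun heq s
        have h5 := hk₀ s hs
        omega
    · intro hk
      exact absurd (Finset.mem_filter.mpr ⟨hk₀mem, fun p => ⟨β p, hpt p⟩⟩) hk
  · rw [Set.indicator_of_notMem hβ]
    refine Finset.sum_eq_zero fun k hk => if_neg fun heq => ?_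
    rw [Finset.mem_filter] at hk
    have hval : ∀ p, β p = ⌊boxPoint N k p⌋ := fun p => (congrFun heq p).symm
    have hval' : ∀ s ∉ J, β s = k s := fun s hs => (hval s).trans (hcoord k hk.1 hk.2 s hs)
    refine hβ ⟨fun s hs => ?_, fun s hs => ?_, fun p => ?_⟩
    · rw [hval' s hs]; positivity
    · have hs' := Finset.mem_compl.mp hs
      rw [hval' s hs']
      exact_mod_cast (mem_boxIndices.mp hk.1).2 s hs'
    · rw [hval p, hint k hk.2 p, boxPoint_eq (mem_boxIndices.mp hk.1).1]
      congr 1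
      refine Finset.sum_congr rfl fun s hs => ?_
      rw [hval' s (Finset.mem_compl.mp hs), Int.cast_natCast]

theorem mono_one_pow {n r : ℕ} (κ : Fin (n + r) → ℚ) (a : ℕ) :
    (mono κ 1 : FracSeries n r) ^ a = mono (a • κ) 1 := by
  induction a with
  | zero => rw [pow_zero, zero_smul, mono_zero_one]
  | succ a ih => rw [pow_succ, ih, mono_mul, succ_nsmul, mul_one]

theorem prod_mono_one {n r : ℕ} {ι : Type*} (s : Finset ι) (f : ι → Fin (n + r) → ℚ) :
    ∏ k ∈ s, (mono (f k) 1 : FracSeries n r) = mono (∑ k ∈ s, f k) 1 := by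
  classical
  induction s using Finset.induction_on with
  | empty => rw [Finset.prod_empty, Finset.sum_empty, mono_zero_one]
  | insert k s hk ih => rw [Finset.prod_insert hk, Finset.sum_insert hk, ih, mono_mul, mul_one]

/-- Replacing each denominator factor `1 - x` by `1 - x^D` turns the numerator into the sum over a
box. -/
theorem eratRest_mul_prod {n r : ℕ} (M : Matrix (Fin (n + r)) (Fin (n + 1)) ℚ) (J : Finset (Fin n))
    (D : ℕ) (hne : ∀ s ∉ J, (1 - mono (fun p => M p s.castSucc) 1 : FracSeries n r) ≠ 0) :
    (∏ s ∈ Jᶜ, (1 - mono (D • fun p => M p s.castSucc) 1)) * eratRest M J =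
      ∑ k ∈ boxIndices J D,
        mono ((fun p => M p (Fin.last n)) + ∑ s, k s • fun p => M p s.castSucc) 1 := by
  have hden : ∏ s, (1 - mono (fun p => M p s.castSucc) (if s ∈ J then 0 else 1)) =
      (∏ s ∈ Jᶜ, (1 - mono (fun p => M p s.castSucc) 1) : FracSeries n r) := by
    rw [← Finset.prod_subset (Finset.subset_univ Jᶜ)]
    · refine Finset.prod_congr rfl fun s hs => ?_
      rw [if_neg (Finset.mem_compl.mp hs)]
    · intro s _ hs
      rw [if_pos (by simpa using hs), mono_coef_zero, sub_zero]
  have hnum : (∏ s ∈ Jᶜ, (1 - mono (D • fun p => M p s.castSucc) 1) : FracSeries n r) =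
      (∏ s ∈ Jᶜ, (1 - mono (fun p => M p s.castSucc) 1)) *
      ∏ s, ∑ a ∈ (if s ∈ J then {0} else Finset.range D), mono (a • fun p => M p s.castSucc) 1 := by
    rw [← Finset.prod_subset (Finset.subset_univ Jᶜ), ← Finset.prod_mul_distrib]
    · refine Finset.prod_congr rfl fun s hs => ?_
      rw [if_neg (Finset.mem_compl.mp hs)]
      simp only [← mono_one_pow]
      exact (mul_neg_geom_sum _ D).symm
    · intro s _ hs
      rw [if_pos (by simpa using hs), Finset.sum_singleton, zero_smul, mono_zero_one]
  have hne' : (∏ s ∈ Jᶜ, (1 - mono (fun p => M p s.castSucc) 1) : FracSeries n r) ≠ 0 :=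
    Finset.prod_ne_zero_iff.mpr fun s hs => hne s (Finset.mem_compl.mp hs)
  rw [eratRest, hden, hnum, mul_comm (∏ s ∈ Jᶜ, _), mul_assoc, mul_div_cancel₀ _ hne',
    Finset.prod_univ_sum, Finset.sum_mul, boxIndices]
  refine Finset.sum_congr rfl fun k _ => ?_
  rw [prod_mono_one, mono_mul, mul_one, add_comm]

/-- If the `λ`-rows are eliminated, the integral part of the remaining function is the generating
function of the lattice points of the cone. -/
theorem isLatticeGF_eratRest {n r : ℕ} {M : Matrix (Fin (n + r)) (Fin (n + 1)) ℚ}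
    {J : Finset (Fin n)} (h : HasIdentityBlock (yRows M) J)
    (hlam : ∀ i, ∀ s ∉ J, M (lamIdx n i) s.castSucc = 0)
    (hlast : ∀ i, M (lamIdx n i) (Fin.last n) = 0) :
    IsLatticeGF (shiftedCone (coneGens (yRows M) J) (coneVertex (yRows M)))
      (expProj (yFractional n r 1) (eratRest M J)) := by
  classical
  obtain ⟨D, hD, hDint⟩ := exists_common_denominator
    (fun k : Fin n × Fin n => yRows M k.2 k.1.castSucc)
  choose g' hg' using hDint
  let g : Fin n → Fin n → ℤ := fun s p => g' (s, p)
  have hg : ∀ s p, (g s p : ℚ) = D * yRows M p s.castSucc := fun s p => (hg' (s, p)).symm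
  have hgcol : ∀ s ∉ J, yExp r (g s) = D • fun p => M p s.castSucc := by
    intro s hs
    funext q
    refine Fin.addCases (fun p => ?_) (fun i => ?_) q
    · refine (yExp_yIdx (g s) p).trans ((hg s p).trans ?_)
      rw [Pi.smul_apply, nsmul_eq_mul]
      rfl
    · refine (yExp_lamIdx (g s) i).trans ?_
      have h0 : M (Fin.natAdd n i) s.castSucc = 0 := hlam i s hs
      rw [Pi.smul_apply, h0, smul_zero]
  have hcol : ∀ s ∉ J, M (yIdx r s) s.castSucc = 1 := h.diag
  have hne : ∀ s ∉ J, (1 - mono (fun p => M p s.castSucc) 1 : FracSeries n r) ≠ 0 := by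
    intro s hs h0
    have h1 := congrFun ((mono_eq_one_iff _ _).mp (sub_eq_zero.mp h0).symm).1 (yIdx r s)
    rw [hcol s hs] at h1
    exact one_ne_zero h1
  let Q : AddMonoidAlgebra ℂ (Fin n → ℤ) := ∏ s ∈ Jᶜ, (1 - AddMonoidAlgebra.single (g s) 1)
  have hQ : laurentYHom r Q =
      ∏ s ∈ Jᶜ, (1 - mono (D • fun p => M p s.castSucc) 1 : FracSeries n r) := by
    rw [map_prod]
    refine Finset.prod_congr rfl fun s hs => ?_
    rw [map_sub, map_one, laurentYHom_single, hgcol s (Finset.mem_compl.mp hs)]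
  have hQ0 : laurentYHom r Q ≠ 0 := by
    rw [hQ, Finset.prod_ne_zero_iff]
    intro s hs h0
    have h1 := congrFun ((mono_eq_one_iff _ _).mp (sub_eq_zero.mp h0).symm).1 (yIdx r s)
    rw [Pi.smul_apply, hcol s (Finset.mem_compl.mp hs), nsmul_eq_mul, mul_one] at h1
    exact hD (Nat.cast_eq_zero.mp h1)
  -- `Q` has integral exponents, so multiplication by it commutes with the projection.
  have hQmem : laurentYHom r Q ∈ expScalars (yFractional n r 1) := by
    rw [map_prod]
    refine Subring.prod_mem _ fun s _ => ?_
    rw [map_sub, map_one, laurentYHom_single]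
    refine one_sub_mono_mem_expScalars (Or.inr (mem_yFractional_one.mpr fun p => ⟨g s p, ?_⟩))
    exact yExp_yIdx _ _
  refine ⟨(boxPolynomial (yRows M) J D).coeff, Q.coeff, ?_, fun β => ?_, ?_⟩
  · intro h0
    have : Q = 0 := AddMonoidAlgebra.coeffEquiv.injective h0
    exact hQ0 (by rw [this, map_zero])
  · rw [← laurentAction_apply, latticeCoeff_shiftedCone h D,
      laurentAction_prod_boxPoints h (fun s _ => hg s) (Finset.Subset.refl _),
      coeff_boxPolynomial h]
  · rw [laurentY_eq, laurentY_eq, eq_div_iff hQ0, mul_comm, ← hQmem, hQ,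
      eratRest_mul_prod M J D hne, map_sum, boxPolynomial, map_sum, Finset.sum_filter]
    refine Finset.sum_congr rfl fun k hk => ?_
    have hy : ∀ p, ((fun p => M p (Fin.last n)) + ∑ s, k s • fun p => M p s.castSucc) (yIdx r p) =
        boxPoint (yRows M) k p := by
      intro p
      rw [Pi.add_apply, Finset.sum_apply, boxPoint]
      simp only [Pi.smul_apply, nsmul_eq_mul]
      rfl
    have hz : ∀ i, ((fun p => M p (Fin.last n)) + ∑ s, k s • fun p => M p s.castSucc)
        (lamIdx n i) = 0 := by
      intro i
      rw [Pi.add_apply, Finset.sum_apply, hlast i, zero_add]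
      refine Finset.sum_eq_zero fun s _ => ?_
      by_cases hs : s ∈ J
      · rw [(mem_boxIndices.mp hk).1 s hs, zero_smul, Pi.zero_apply]
      · rw [Pi.smul_apply, hlam i s hs, smul_zero]
    rw [expProj_mono, mem_yFractional_one]
    simp only [hy]
    split_ifs with hint
    · rw [laurentYHom_single]
      congr 1
      funext q
      refine Fin.addCases (fun p => ?_) (fun i => ?_) q
      · refine (hy p).trans (Eq.trans ?_ (yExp_yIdx _ p).symm)
        obtain ⟨m, hm⟩ := hint p
        rw [hm, Int.floor_intCast]
      · exact (hz i).trans (yExp_lamIdx _ i).symm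
    · rfl

/-! ### Pivot sequences -/

theorem PivotSequence.nodup_cols {n r : ℕ} {A : Matrix (Fin r) (Fin n) ℤ} {b : Fin r → ℤ}
    {i : Fin r → Fin r} {j : Fin r → Fin n} (h : PivotSequence A b i j) :
    ((List.ofFn fun k => (i k, j k)).map Prod.snd).Nodup := by
  rw [List.map_ofFn]
  exact List.nodup_ofFn.mpr h.cols_inj

theorem toFinset_cols {n r : ℕ} (i : Fin r → Fin r) (j : Fin r → Fin n) :
    ((List.ofFn fun k => (i k, j k)).map Prod.snd).toFinset = Finset.univ.image j := by
  ext s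
  simp [List.mem_ofFn]

theorem PivotSequence.isPartlyEliminated {n r : ℕ} {A : Matrix (Fin r) (Fin n) ℤ}
    {b : Fin r → ℤ} {i : Fin r → Fin r} {j : Fin r → Fin n} (h : PivotSequence A b i j) :
    IsPartlyEliminated (pivots (systemMatrix A b) (List.ofFn fun k => (i k, j k)))
      (Finset.univ.image j) := by
  have h1 := (isPartlyEliminated_systemMatrix A b).pivotList _ h.nodup_cols (by simp)
  rwa [Finset.empty_union, toFinset_cols] at h1

theorem PivotSequence.hasIdentityBlock {n r : ℕ} {A : Matrix (Fin r) (Fin n) ℤ}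
    {b : Fin r → ℤ} {i : Fin r → Fin r} {j : Fin r → Fin n} (h : PivotSequence A b i j) :
    HasIdentityBlock (pivotedMatrix A b i j) (Finset.univ.image j) :=
  ⟨h.isPartlyEliminated.diag, h.isPartlyEliminated.offDiag, h.isPartlyEliminated.last⟩

/-- After `r` pivots the `λ`-rows vanish outside the pivot columns. -/
theorem PivotSequence.lam_eq_zero {n r : ℕ} {A : Matrix (Fin r) (Fin n) ℤ}
    {b : Fin r → ℤ} {i : Fin r → Fin r} {j : Fin r → Fin n} (h : PivotSequence A b i j)
    (i' : Fin r) {t : Fin (n + 1)} (ht : ∀ s ∈ Finset.univ.image j, t ≠ s.castSucc) :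
    pivots (systemMatrix A b) (List.ofFn fun k => (i k, j k)) (lamIdx n i') t = 0 := by
  obtain ⟨k, rfl⟩ := Finite.surjective_of_injective h.rows_inj i'
  exact pivots_pivotRow _ h.pivots_ne h.nodup_cols (p := (i k, j k))
    (List.mem_ofFn.mpr ⟨k, rfl⟩) (ht _ (Finset.mem_image_of_mem j (Finset.mem_univ k)))

theorem PivotSequence.sign_det {n r : ℕ} {A : Matrix (Fin r) (Fin n) ℤ}
    {b : Fin r → ℤ} {i : Fin r → Fin r} {j : Fin r → Fin n} (h : PivotSequence A b i j) :
    (SignType.sign (A.submatrix i j).det : ℤ) =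
      pivotSign (systemMatrix A b) (List.ofFn fun k => (i k, j k)) ∧
    (A.submatrix i j).det ≠ 0 := by
  have h1 := sign_det_eq_pivotSign i j h.cols_inj (systemMatrix A b) h.pivots_ne
  have h2 : (Matrix.of fun s t => systemMatrix A b (lamIdx n (i s)) (j t).castSucc) =
      (Int.castRingHom ℚ).mapMatrix (A.submatrix i j) := by
    ext s t
    simp [systemMatrix_lam_castSucc]
  rw [h2, ← RingHom.map_det, eq_intCast] at h1
  refine ⟨?_, fun h0 => h1.2 (by rw [h0, Int.cast_zero])⟩
  rw [← h1.1, sign_intCast]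

/-- A column outside `J` solves a linear system whose solution is unique, because the minor of the
columns in `J` is nonzero. -/
theorem PivotSequence.column_eq {n r : ℕ} {A : Matrix (Fin r) (Fin n) ℤ} {b : Fin r → ℤ}
    {i i' : Fin r → Fin r} {j j' : Fin r → Fin n} (h : PivotSequence A b i j)
    (h' : PivotSequence A b i' j') (hJ : Finset.univ.image j' = Finset.univ.image j)
    {t : Fin (n + 1)} (ht : ∀ s ∈ Finset.univ.image j, t ≠ s.castSucc)
    (hoff : ∀ s ∉ Finset.univ.image j, pivotedMatrix A b i' j' s t = pivotedMatrix A b i j s t)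
    (p : Fin n) : pivotedMatrix A b i' j' p t = pivotedMatrix A b i j p t := by
  classical
  set d : Fin n → ℚ := fun p => pivotedMatrix A b i' j' p t - pivotedMatrix A b i j p t with hd
  -- The difference of the two columns is in the kernel of `A`.
  have hAd : ∀ q, ∑ p, (A q p : ℚ) * d p = 0 := by
    intro q
    have h1 := (isSystemMatrix_systemMatrix A b).pivotList (List.ofFn fun k => (i k, j k)) q t
    have h2 := (isSystemMatrix_systemMatrix A b).pivotList (List.ofFn fun k => (i' k, j' k)) q t
    rw [h.lam_eq_zero q ht] at h1
    rw [h'.lam_eq_zero q (fun s hs => ht s (hJ ▸ hs))] at h2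
    simp only [hd, mul_sub, Finset.sum_sub_distrib]
    change ∑ p, (A q p : ℚ) * pivots _ _ (yIdx r p) t - ∑ p, (A q p : ℚ) *
      pivots _ _ (yIdx r p) t = 0
    linarith
  have hd0 : ∀ s ∉ Finset.univ.image j, d s = 0 := fun s hs => sub_eq_zero.mpr (hoff s hs)
  have hmul : ((Int.castRingHom ℚ).mapMatrix (A.submatrix i j)).mulVec (d ∘ j) = 0 := by
    funext q
    have h1 := hAd (i q)
    rw [← Finset.sum_subset (Finset.subset_univ (Finset.univ.image j)),
      Finset.sum_image fun a _ c _ hac => h.cols_inj hac] at h1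
    · exact h1
    · intro s _ hs
      rw [hd0 s hs, mul_zero]
  have hdet : ((Int.castRingHom ℚ).mapMatrix (A.submatrix i j)).det ≠ 0 := by
    rw [← RingHom.map_det, eq_intCast]
    exact Int.cast_ne_zero.mpr h.sign_det.2
  have hdj := Matrix.eq_zero_of_mulVec_eq_zero hdet hmul
  have hp0 : d p = 0 := by
    by_cases hp : p ∈ Finset.univ.image j
    · obtain ⟨k, -, rfl⟩ := Finset.mem_image.mp hp
      exact congrFun hdj k
    · exact hd0 p hp
  exact sub_eq_zero.mp hp0

theorem PivotSequence.isLatticeGF {n r : ℕ} {A : Matrix (Fin r) (Fin n) ℤ} {b : Fin r → ℤ}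
    {i : Fin r → Fin r} {j : Fin r → Fin n} (h : PivotSequence A b i j) :
    IsLatticeGF (shiftedCone (coneGens (pivotedMatrix A b i j) (Finset.univ.image j))
      (coneVertex (pivotedMatrix A b i j)))
      (expProj (yFractional n r 1) (eratRest
        (pivots (systemMatrix A b) (List.ofFn fun k => (i k, j k))) (Finset.univ.image j))) :=
  isLatticeGF_eratRest h.hasIdentityBlock
    (fun i' _ hs => h.lam_eq_zero i' fun _ hs' h' =>
      hs (Fin.castSucc_injective n h' ▸ hs'))
    (fun i' => h.lam_eq_zero i' fun s _ => (Fin.castSucc_lt_last s).ne')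

theorem PivotSequence.isIterCT {n r : ℕ} {A : Matrix (Fin r) (Fin n) ℤ} {b : Fin r → ℤ}
    {i : Fin r → Fin r} {j : Fin r → Fin n} (h : PivotSequence A b i j) :
    IsIterCT (List.ofFn fun k => (i k, j k)) (erat (systemMatrix A b))
      (((SignType.sign (A.submatrix i j).det : ℤ) : FracSeries n r) *
        expProj (yFractional n r 1) (eratRest
          (pivots (systemMatrix A b) (List.ofFn fun k => (i k, j k))) (Finset.univ.image j))) := by
  have h1 := isIterCT_eratRest _ (isPartlyEliminated_systemMatrix A b) h.nodup_cols (by simp)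
    h.pivots_ne
  rw [Finset.empty_union, toFinset_cols, expProj_eratRest, ← erat_eq_eratRest, ← h.sign_det.1]
    at h1
  · exact h1
  · intro s _
    refine mem_yFractional_one.mpr fun p => ⟨if p = s then 1 else 0, ?_⟩
    rw [systemMatrix_y_castSucc]
    split_ifs <;> simp
  · exact mem_yFractional_one.mpr fun p => ⟨0, by rw [systemMatrix_y_last, Int.cast_zero]⟩

theorem theorem3p6 {n r : ℕ} (A : Matrix (Fin r) (Fin n) ℤ) (b : Fin r → ℤ)
    (i : Fin r → Fin r) (j : Fin r → Fin n) (h : PivotSequence A b i j) :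
    -- the generators are linearly independent
    LinearIndependent ℝ (coneGens (pivotedMatrix A b i j) (Finset.univ.image j)) ∧
    -- the iterated constant term is defined, and is the signed generating function
    (∃ σ : FracSeries n r,
      (∀ R : FracSeries n r,
        IsLatticeGF (shiftedCone (coneGens (pivotedMatrix A b i j) (Finset.univ.image j))
          (coneVertex (pivotedMatrix A b i j))) R ↔ R = σ) ∧
      ∀ R : FracSeries n r,
        IsIterCT (List.ofFn fun k => (i k, j k)) (erat (systemMatrix A b)) R ↔
          R = ((SignType.sign (A.submatrix i j).det : ℤ) : FracSeries n r) * σ) ∧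
    -- generators and vertex depend only on the set of pivot columns
    (∀ (i' : Fin r → Fin r) (j' : Fin r → Fin n), PivotSequence A b i' j' →
      Finset.univ.image j' = Finset.univ.image j →
        (∀ s, s ∉ Finset.univ.image j → ∀ p,
          pivotedMatrix A b i' j' p s.castSucc = pivotedMatrix A b i j p s.castSucc) ∧
        ∀ p, pivotedMatrix A b i' j' p (Fin.last n) = pivotedMatrix A b i j p (Fin.last n)) := by
  refine ⟨h.hasIdentityBlock.linearIndependent, ⟨_, fun R => ⟨fun hR => hR.unique h.isLatticeGF,
    fun hR => hR ▸ h.isLatticeGF⟩, fun R => ⟨fun hR => hR.unique h.isIterCT,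
    fun hR => hR ▸ h.isIterCT⟩⟩, fun i' j' h' hJ => ⟨fun s hs => ?_, ?_⟩⟩
  · refine h.column_eq h' hJ (fun t ht hst => hs (Fin.castSucc_injective n hst ▸ ht)) ?_
    intro t ht
    have ht' : t ∉ Finset.univ.image j' := hJ ▸ ht
    by_cases hst : s = t
    · rw [hst, h.hasIdentityBlock.diag t ht, h'.hasIdentityBlock.diag t ht']
    · rw [h.hasIdentityBlock.offDiag t ht s hs hst,
        h'.hasIdentityBlock.offDiag t ht' s (hJ ▸ hs) hst]
  · refine h.column_eq h' hJ (fun t _ => (Fin.castSucc_lt_last t).ne') fun t ht => ?_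
    rw [h.hasIdentityBlock.last t ht, h'.hasIdentityBlock.last t (hJ ▸ ht)]
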